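/- **Theorem 5 (generalized dressing cosets, gauge symmetry).** Let $D$ be a finite-dimensional real Lie group whose Lie algebra ${\cal D}$ carries a non-degenerate symmetric invariant bilinear form $\langle\cdot|\cdot\rangle$ and is the direct sum of two isotropic Lie subalgebras ${\cal G}$ and $\hat{\cal G}$, with projections $J:{\cal D}\to{\cal G}$ and $\hat J:{\cal D}\to\hat{\cal G}$ along the other summand. Let $R:\mathrm{Dom} R\to{\cal G}$ and $\hat R:\mathrm{Dom}\hat R\to\hat{\cal G}$ be linear operators on subspaces $\mathrm{Dom} R\subset\hat{\cal G}$, $\mathrm{Dom}\hat R\subset{\cal G}$, and let $R^*:\mathrm{Dom}R^*\to{\cal G}$ and $\hat R^*:\mathrm{Dom}\hat R^*\to\hat{\cal G}$, with $\mathrm{Dom}R^*\subset\hat{\cal G}$, $\mathrm{Dom}\hat R^*\subset{\cal G}$, be linear operators adjoint to them, i.e. $\langle R^*x|y\rangle=\langle x|Ry\rangle$ for $x\in\mathrm{Dom}R^*$, $y\in\mathrm{Dom}R$, and likewise for $\hat R^*$. Assume 1. $\mathrm{Ker} R=\mathrm{Ker} R^*$ and $\mathrm{Ker}\hat R=\mathrm{Ker}\hat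 R^*$; 2. $(R|_{\mathrm{Im}\hat R})^{-1}=\hat R|_{\mathrm{Im}R}$; 3. $\mathrm{Dom}R$ is the annihilator of $\mathrm{Ker}\hat R$ in $\hat{\cal G}$, and $\mathrm{Dom}\hat R$ is the annihilator of $\mathrm{Ker}R$ in ${\cal G}$; 4. $\mathrm{Im}\hat R\subset\mathrm{Dom}R$ and $\mathrm{Im}R\subset\mathrm{Dom}\hat R$; 5. $\mathrm{Dom}R=\mathrm{Dom}R^*$ and $\mathrm{Dom}\hat R=\mathrm{Dom}\hat R^*$; 6. $\langle\cdot|\cdot\rangle$ is non-degenerate on $\mathrm{Im}R\oplus\mathrm{Im}\hat R$. Put ${\cal R}=\mathrm{Ker}\hat R\oplus\{\gamma+R\gamma:\gamma\in\mathrm{Dom}R\}$, ${\cal R}^\perp=\mathrm{Ker}\hat R\oplus\{\gamma-R^*\gamma:\gamma\in\mathrm{Dom}R^*\}$ and ${\cal F}={\cal R}\cap{\cal R}^\perp$. Assume that ${\cal F}$ is a Lie subalgebra of ${\cal D}$, let $F\subset D$ be a connected Lie subgroup with Lie algebra ${\cal F}$, and assume that for all $f\in F$ $$J\mathrm{Ad}_f\hat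 J+J[\mathrm{Ad}_f,R]\hat J=R\,\mathrm{Ad}_fR \ \text{ on } \mathrm{Dom}R,\qquad \hat J\mathrm{Ad}_fJ+\hat J[\mathrm{Ad}_f,\hat R]J=\hat R\,\mathrm{Ad}_f\hat R\ \text{ on }\mathrm{Dom}\hat R,$$ where $R$ and $\hat R$ act on elements of ${\cal D}$ through $R\hat J$ and $\hat RJ$; it is part of the hypothesis that all terms are defined, i.e. that $\hat J\mathrm{Ad}_f\gamma$ and $\hat J\mathrm{Ad}_fR\gamma$ lie in $\mathrm{Dom}R$ for $\gamma\in\mathrm{Dom}R$, and similarly for $\hat R$. Then the following holds. (a) $\mathrm{Ad}_f\,\mathrm{Ker}R\subset\mathrm{Ker}R$ and $\mathrm{Ad}_f\,\mathrm{Ker}\hat R\subset\mathrm{Ker}\hat R$ for all $f\in F$. (b) Every $X\in{\cal F}^\perp$ can be written as $X=\alpha_++\alpha_-+R\alpha_+-R^*\alpha_-+\alpha_0$ with $\alpha_\pm\in\mathrm{Dom}R$ and $\alpha_0\in\mathrm{Ker}\hat R$, and $K(X)=2\langle\alpha_+|R\alpha_+\rangle+2\langle\alpha_-|R\alpha_-\rangle$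 does not depend on the choice of such a decomposition. (c) Let the world-sheet be an open set $U\subset\mathbb{R}^2$ with coordinates $(\tau,\sigma)$, let $B$ be any smooth 2-form on $D$ with $dB=\langle\theta\wedge[\theta\wedge\theta]\rangle$, where $\theta=dg\,g^{-1}$ is the right-invariant Maurer-Cartan form (the 3-form takes the value $6\langle\theta(X)|[\theta(Y),\theta(Z)]\rangle$ on $X,Y,Z$), and for smooth fields $l:U\to D$ and $\Lambda:U\to{\cal F}$ let $${\cal S}_W(l,\Lambda)=\int_W\Big(\tfrac12\langle\partial_\tau ll^{-1}|\partial_\sigma ll^{-1}\rangle+\tfrac1{12}(l^*B)(\partial_\sigma,\partial_\tau)+\tfrac12K(\partial_\sigma ll^{-1})+\langle\Lambda|\partial_\sigma ll^{-1}\rangle\Big)d\tau d\sigma$$ be the first-order action over a compact set $W\subset U$. Let $f:U\to F$ be a gauge transformation supported in $W$ and connected to the identity, i.e. a field which can be deformed smoothly to the constant field $1$ through $F$-valued fields equal to $1$ outside $W$. Under $$l\mapsto l'=fl,\qquad \Lambda\mapsto\Lambda'=f\Lambda f^{-1}-\partial_\tau ff^{-1},$$ $\Lambda'$ is again ${\cal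 F}$-valued, and the constraint $\partial_\sigma ll^{-1}\in{\cal F}^\perp$ is equivalent at each point to $\partial_\sigma l'l'^{-1}\in{\cal F}^\perp$. If $\partial_\sigma ll^{-1}\in{\cal F}^\perp$ on $U$, then ${\cal S}_W(l',\Lambda')={\cal S}_W(l,\Lambda)$. For all $l$ and $\Lambda$, with or without the constraint, the same equality holds for the action without the term $K$. The integrands are integrable on $W$ in all these cases. -/

import Mathlib

open scoped Manifold ContDiff
open MeasureTheory

noncomputable section

namespace DressingCosets

/-- Over `ℝ` the order of smoothness that Mathlib requires for the Lie algebra structure of a Lie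
group is `3`, so every smooth Lie group qualifies. -/
instance instLEInftyMinSmoothness : ENat.LEInfty (minSmoothness ℝ 3) :=
  ⟨by simpa using (ENat.LEInfty.out : (3 : WithTop ℕ∞) ≤ ∞)⟩

/-! ### Linear algebra: partially defined operators on a space with a bilinear form -/

section LinearAlgebra

variable {V : Type*} [AddCommGroup V] [Module ℝ V]

/-- The kernel `{x ∈ Dom R | R x = 0}` of a partially defined linear operator. -/
def opKer (R : V →ₗ.[ℝ] V) : Submodule ℝ V :=
  (LinearMap.ker R.toFun).map R.domain.subtype

/-- The image `{R x | x ∈ Dom R}` of a partially defined linear operator. -/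
def opIm (R : V →ₗ.[ℝ] V) : Submodule ℝ V :=
  LinearMap.range R.toFun

/-- The standing hypotheses on the operators `R : Dom R ⊆ 𝒢' → 𝒢` and `R' : Dom R' ⊆ 𝒢 → 𝒢'` and
on their adjoints `Rs` and `Rs'` with respect to the bilinear form; here `𝒢'` and `R'` are the dual
subalgebra and the dual operator. -/
structure OperatorHypotheses (form : LinearMap.BilinForm ℝ V) (𝒢 𝒢' : Submodule ℝ V)
    (R Rs R' Rs' : V →ₗ.[ℝ] V) : Prop where
  dom_le : R.domain ≤ 𝒢'
  im_le : opIm R ≤ 𝒢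
  dom_le_adj : Rs.domain ≤ 𝒢'
  im_le_adj : opIm Rs ≤ 𝒢
  dom_le' : R'.domain ≤ 𝒢
  im_le' : opIm R' ≤ 𝒢'
  dom_le_adj' : Rs'.domain ≤ 𝒢
  im_le_adj' : opIm Rs' ≤ 𝒢'
  /-- `Rs` is adjoint to `R`. -/
  adjoint : ∀ (x : Rs.domain) (y : R.domain), form (Rs x) y = form x (R y)
  /-- `Rs'` is adjoint to `R'`. -/
  adjoint' : ∀ (x : Rs'.domain) (y : R'.domain), form (Rs' x) y = form x (R' y)
  /-- `Ker R = Ker R^*`. -/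
  ker_eq : opKer R = opKer Rs
  ker_eq' : opKer R' = opKer Rs'
  /-- `Im R' ⊆ Dom R` and `Im R ⊆ Dom R'`. -/
  im_le_dom : opIm R' ≤ R.domain
  im_le_dom' : opIm R ≤ R'.domain
  /-- The restrictions `R : Im R' → Im R` and `R' : Im R → Im R'` are inverse to each other. -/
  left_inv : ∀ x : R.domain, (x : V) ∈ opIm R' → ∀ y : R'.domain, (y : V) = R x → R' y = x
  right_inv : ∀ y : R'.domain, (y : V) ∈ opIm R → ∀ x : R.domain, (x : V) = R' y → R x = y
  /-- `Dom R` is the annihilator of `Ker R'` in `𝒢'`. -/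
  dom_eq_annihilator : ∀ x : V, x ∈ R.domain ↔ x ∈ 𝒢' ∧ ∀ k ∈ opKer R', form k x = 0
  /-- `Dom R'` is the annihilator of `Ker R` in `𝒢`. -/
  dom_eq_annihilator' : ∀ x : V, x ∈ R'.domain ↔ x ∈ 𝒢 ∧ ∀ k ∈ opKer R, form k x = 0
  /-- `Dom R = Dom R^*`. -/
  dom_eq : R.domain = Rs.domain
  dom_eq' : R'.domain = Rs'.domain
  /-- The form is nondegenerate on `Im R ⊕ Im R'`. -/
  nondegenerate : ∀ x ∈ opIm R ⊔ opIm R', (∀ y ∈ opIm R ⊔ opIm R', form x y = 0) → x = 0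

/-- The subspace `Ker R' ⊕ {γ + R γ | γ ∈ Dom R}`. -/
def spaceR (R R' : V →ₗ.[ℝ] V) : Submodule ℝ V :=
  opKer R' ⊔ LinearMap.range (R.domain.subtype + R.toFun)

/-- The subspace `Ker R' ⊕ {γ - R^* γ | γ ∈ Dom R^*}`. -/
def spaceRPerp (Rs R' : V →ₗ.[ℝ] V) : Submodule ℝ V :=
  opKer R' ⊔ LinearMap.range (Rs.domain.subtype - Rs.toFun)

/-- The subspace `ℱ`, the intersection of the two preceding ones. -/
def spaceF (R Rs R' : V →ₗ.[ℝ] V) : Submodule ℝ V :=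
  spaceR R R' ⊓ spaceRPerp Rs R'

/-- `X = α₊ + α₋ + R α₊ - R^* α₋ + α₀` with `α₊, α₋ ∈ Dom R = Dom R^*` and `α₀ ∈ Ker R'`. -/
def IsDecomposition (R Rs R' : V →ₗ.[ℝ] V) (X : V) (αp αm : R.domain) : Prop :=
  ∃ αm' : Rs.domain, (αm' : V) = αm ∧ ∃ α₀ ∈ opKer R', X = αp + αm + R αp - Rs αm' + α₀

open Classical in
/-- The quadratic form `K(X) = 2⟨α₊ | R α₊⟩ + 2⟨α₋ | R α₋⟩`, where `X` is decomposed as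
`α₊ + α₋ + R α₊ - R^* α₋ + α₀`. Only its values on `ℱ^⊥`, where such decompositions exist, matter;
elsewhere it is given the value `0`. -/
def quadK (form : LinearMap.BilinForm ℝ V) (R Rs R' : V →ₗ.[ℝ] V) (X : V) : ℝ :=
  if h : ∃ α : R.domain × R.domain, IsDecomposition R Rs R' X α.1 α.2 then
    2 * form h.choose.1 (R h.choose.1) + 2 * form h.choose.2 (R h.choose.2)
  else 0

/-- The identity `J Ad Ĵ + J [Ad, R] Ĵ = R Ad R` on `Dom R`, for a given linear map `Ad`; `J` and
`J'` are the projections onto the algebra containing `Im R` and the one containing `Dom R`. An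
operator `R` with `Dom R` inside the range of `J'` acts on the whole space as `R J'`, so the
elements to which `R` is applied have to lie in its domain. -/
def IntertwiningIdentity (J J' : V →ₗ[ℝ] V) (R : V →ₗ.[ℝ] V) (Ad : V →ₗ[ℝ] V) : Prop :=
  ∀ γ : R.domain, ∃ (h₁ : J' (Ad γ) ∈ R.domain) (h₂ : J' (Ad (R γ)) ∈ R.domain),
    J (Ad γ) + (J (Ad (R γ)) - J (R ⟨J' (Ad γ), h₁⟩)) = R ⟨J' (Ad (R γ)), h₂⟩

end LinearAlgebra

/-! ### Lie groups -/

section LieGroups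

variable {E : Type*} [NormedAddCommGroup E] [NormedSpace ℝ E]
  {D : Type*} [TopologicalSpace D] [ChartedSpace E D] [Group D]

variable (E) in
/-- The adjoint action `Ad_g` of a Lie group on its Lie algebra: the derivative at `1` of the
conjugation by `g`. -/
def Ad (g : D) : GroupLieAlgebra 𝓘(ℝ, E) D →L[ℝ] GroupLieAlgebra 𝓘(ℝ, E) D :=
  mfderiv 𝓘(ℝ, E) 𝓘(ℝ, E) (fun y : D => g * y * g⁻¹) 1

variable (E) in
/-- The pull-back `du u⁻¹` at `x` of the right-invariant Maurer-Cartan form by a map `u` from a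
normed space to a Lie group: the derivative at `x` of `y ↦ u y * (u x)⁻¹`. -/
def rightLogDeriv {S : Type*} [NormedAddCommGroup S] [NormedSpace ℝ S] (u : S → D) (x : S) :
    S →L[ℝ] GroupLieAlgebra 𝓘(ℝ, E) D :=
  mfderiv 𝓘(ℝ, S) 𝓘(ℝ, E) (fun y : S => u y * (u x)⁻¹) x

variable (E) in
/-- `∂_τ u u⁻¹` at a point `x = (τ, σ)` of the world-sheet. -/
def dτ (u : ℝ × ℝ → D) (x : ℝ × ℝ) : GroupLieAlgebra 𝓘(ℝ, E) D :=
  rightLogDeriv E u x (1, 0)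

variable (E) in
/-- `∂_σ u u⁻¹` at a point `x = (τ, σ)` of the world-sheet. -/
def dσ (u : ℝ × ℝ → D) (x : ℝ × ℝ) : GroupLieAlgebra 𝓘(ℝ, E) D :=
  rightLogDeriv E u x (0, 1)

/-- The Lie algebra of `D` with the bilinear form and the subalgebras `𝒢`, `𝒢'` is the Lie algebra
of a Drinfeld double: the form is symmetric, nondegenerate and invariant, and the subalgebras are
complementary and isotropic. -/
structure IsDrinfeldDouble [LieGroup 𝓘(ℝ, E) ∞ D] [CompleteSpace E]
    (form : LinearMap.BilinForm ℝ (GroupLieAlgebra 𝓘(ℝ, E) D))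
    (𝒢 𝒢' : LieSubalgebra ℝ (GroupLieAlgebra 𝓘(ℝ, E) D)) : Prop where
  symm : ∀ X Y, form X Y = form Y X
  nondegenerate : form.Nondegenerate
  invariant_Ad : ∀ (g : D) X Y, form (Ad E g X) (Ad E g Y) = form X Y
  invariant_ad : ∀ X Y Z, form ⁅X, Y⁆ Z = form X ⁅Y, Z⁆
  isCompl : IsCompl 𝒢.toSubmodule 𝒢'.toSubmodule
  isotropic : ∀ X ∈ 𝒢, ∀ Y ∈ 𝒢, form X Y = 0
  isotropic' : ∀ X ∈ 𝒢', ∀ Y ∈ 𝒢', form X Y = 0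

/-- A smooth 2-form `B` on `D` with `dB = ⟨θ ∧ [θ ∧ θ]⟩`, where `θ` is the right-invariant
Maurer-Cartan form; the 3-form `⟨θ ∧ [θ ∧ θ]⟩` takes the value `6 ⟨θ X, [θ Y, θ Z]⟩` on `X, Y, Z`.
The 2-form is given in the right trivialization of the tangent bundle:
`B_g (X, Y) = b g (θ X, θ Y)`. The equality of 3-forms is tested on the pull-backs by all smooth
maps from open sets of a three-dimensional space. -/
def IsWZPrimitive (form : LinearMap.BilinForm ℝ (GroupLieAlgebra 𝓘(ℝ, E) D))
    (b : D → E [⋀^Fin 2]→L[ℝ] ℝ) : Prop :=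
  ContMDiff 𝓘(ℝ, E) 𝓘(ℝ, E [⋀^Fin 2]→L[ℝ] ℝ) ∞ b ∧
  ∀ (O : Set (ℝ × ℝ × ℝ)) (u : ℝ × ℝ × ℝ → D), IsOpen O →
    ContMDiffOn 𝓘(ℝ, ℝ × ℝ × ℝ) 𝓘(ℝ, E) ∞ u O →
    ∀ y ∈ O, ∀ v : Fin 3 → ℝ × ℝ × ℝ,
      extDeriv (fun z => (b (u z)).compContinuousLinearMap
        (rightLogDeriv E u z : ℝ × ℝ × ℝ →L[ℝ] E)) y v =
      6 * form (rightLogDeriv E u y (v 0)) ⁅rightLogDeriv E u y (v 1), rightLogDeriv E u y (v 2)⁆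

/-- The density with respect to `dτ dσ` of the first-order action at a point of the world-sheet,
for the field `l` and the Lagrange multiplier `Λ`. The world-sheet is oriented by `dσ ∧ dτ`. -/
def lagrangian (form : LinearMap.BilinForm ℝ (GroupLieAlgebra 𝓘(ℝ, E) D))
    (b : D → E [⋀^Fin 2]→L[ℝ] ℝ) (K : GroupLieAlgebra 𝓘(ℝ, E) D → ℝ)
    (l : ℝ × ℝ → D) (Λ : ℝ × ℝ → GroupLieAlgebra 𝓘(ℝ, E) D) (x : ℝ × ℝ) : ℝ :=
  1 / 2 * form (dτ E l x) (dσ E l x) + 1 / 12 * b (l x) ![dσ E l x, dτ E l x]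
    + 1 / 2 * K (dσ E l x) + form (Λ x) (dσ E l x)

/-- The first-order action over a part `W` of the world-sheet. -/
def action (form : LinearMap.BilinForm ℝ (GroupLieAlgebra 𝓘(ℝ, E) D))
    (b : D → E [⋀^Fin 2]→L[ℝ] ℝ) (K : GroupLieAlgebra 𝓘(ℝ, E) D → ℝ) (W : Set (ℝ × ℝ))
    (l : ℝ × ℝ → D) (Λ : ℝ × ℝ → GroupLieAlgebra 𝓘(ℝ, E) D) : ℝ :=
  ∫ x in W, lagrangian form b K l Λ x

variable {E₁ : Type*} [NormedAddCommGroup E₁] [NormedSpace ℝ E₁]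
  {F : Type*} [TopologicalSpace F] [ChartedSpace E₁ F] [Group F]

/-- The homomorphism `ι : F → D` makes `F` a (not necessarily embedded) Lie subgroup of `D` with
Lie algebra `ℱ`: it is smooth, it is an injective immersion, and the range of its derivative at `1`
is `ℱ`. -/
structure IsLieSubgroup (ι : F →* D) (ℱ : Submodule ℝ (GroupLieAlgebra 𝓘(ℝ, E) D)) : Prop where
  smooth : ContMDiff 𝓘(ℝ, E₁) 𝓘(ℝ, E) ∞ ι
  injective : Function.Injective ι
  immersive : Function.Injective (mfderiv 𝓘(ℝ, E₁) 𝓘(ℝ, E) ι 1)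
  range_deriv : ∀ X : GroupLieAlgebra 𝓘(ℝ, E) D,
    X ∈ ℱ ↔ ∃ Y : GroupLieAlgebra 𝓘(ℝ, E₁) F, mfderiv 𝓘(ℝ, E₁) 𝓘(ℝ, E) ι 1 Y = X

/-- A gauge transformation on the world-sheet `U` supported in `W ⊆ U`: an `F`-valued field that
can be deformed smoothly to the constant `1`, through fields that are `1` outside `W`. -/
def IsGaugeTransformation (U W : Set (ℝ × ℝ)) (f : ℝ × ℝ → F) : Prop :=
  ∃ h : ℝ × (ℝ × ℝ) → F,
    ContMDiffOn 𝓘(ℝ, ℝ × (ℝ × ℝ)) 𝓘(ℝ, E₁) ∞ h (Set.univ ×ˢ U) ∧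
    (∀ x ∈ U, h (0, x) = 1) ∧ (∀ x ∈ U, h (1, x) = f x) ∧
    ∀ s, ∀ x ∈ U \ W, h (s, x) = 1

/-- The gauge transform `f l` of the field `l`. -/
def gaugeField (ι : F →* D) (f : ℝ × ℝ → F) (l : ℝ × ℝ → D) : ℝ × ℝ → D :=
  fun x => ι (f x) * l x

/-- The gauge transform `f Λ f⁻¹ - ∂_τ f f⁻¹` of the Lagrange multiplier `Λ`. -/
def gaugeMultiplier (ι : F →* D) (f : ℝ × ℝ → F) (Λ : ℝ × ℝ → GroupLieAlgebra 𝓘(ℝ, E) D) :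
    ℝ × ℝ → GroupLieAlgebra 𝓘(ℝ, E) D :=
  fun x => Ad E (ι (f x)) (Λ x) - dτ E (fun y => ι (f y)) x

end LieGroups

end DressingCosets

end

/-! The algebra rests on one duality: since `Dom R` is the annihilator of `Ker R'`, the space
`spaceRPerp` is the whole orthogonal complement of `spaceR` (`orthogonal_spaceR`). Hence `ℱ` is
isotropic and `ℱ^⊥` is the sum of the two spaces. For `p` in the first and `q` in the second, `K(p +
q) = ⟨p|p⟩ - ⟨q|q⟩` (`quadK_add`). Two splittings of the same vector differ by an element of `ℱ`,
which is orthogonal to both spaces, so `K` is well defined. For the same reason `K` is unchanged by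
translations along `ℱ` and by isometries preserving both spaces (`quadK_map_add`).

The intertwining identity says that `Ad_f` maps the graph `{γ + R γ}` into itself (`map_graph`). The
domain clauses of the two identities imply that `Ad_f` preserves `Dom R ⊕ Dom R'`, the orthogonal
complement of `Ker R ⊕ Ker R'`; so it preserves the latter sum, and the graph property separates the
two kernels (`map_opKer`). Thus `Ad_f` preserves `spaceR` and, being an isometry, `spaceRPerp`. As
`∂_σ l' l'⁻¹ = ∂_σ f f⁻¹ + Ad_f (∂_σ l l⁻¹)` with the first term in `ℱ`, the constraint and the `K`
term are invariant point by point.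

The other terms are followed along the deformation `u = k l` of `l`, where `k` joins `1` to `f`. By
invariance of the form and isotropy of `ℱ`, the multiplier term changes by `-⟨∂_τ k k⁻¹ | ∂_σ u
u⁻¹⟩`. The Maurer-Cartan equation for `u` and for `k` (`maurerCartan`), the equation for `dB` and
the isotropy of `ℱ` turn the `s`-derivative of the density into a divergence
(`fderiv_density_eq_divergence`). Its currents are linear in `∂_s k k⁻¹`, which vanishes outside
`W`, so the integral over `W` does not depend on `s`. -/

noncomputable section

namespace DressingCosets

/-! ### Partially defined operators and pairs of complementary isotropic subspaces -/

section LinearAlgebra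

variable {V : Type*} [AddCommGroup V] [Module ℝ V]

theorem mem_opKer {R : V →ₗ.[ℝ] V} {X : V} :
    X ∈ opKer R ↔ ∃ h : X ∈ R.domain, R ⟨X, h⟩ = 0 := by
  constructor
  · rintro ⟨y, hy, rfl⟩
    exact ⟨y.2, hy⟩
  · rintro ⟨h, h0⟩
    exact ⟨⟨X, h⟩, h0, rfl⟩

theorem apply_mem_opIm (R : V →ₗ.[ℝ] V) (x : R.domain) : R x ∈ opIm R := ⟨x, rfl⟩

theorem mem_spaceR {R R' : V →ₗ.[ℝ] V} {X : V} :
    X ∈ spaceR R R' ↔ ∃ k ∈ opKer R', ∃ γ : R.domain, X = k + (γ + R γ) := by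
  rw [spaceR, Submodule.mem_sup]
  constructor
  · rintro ⟨k, hk, _, ⟨γ, rfl⟩, rfl⟩
    exact ⟨k, hk, γ, rfl⟩
  · rintro ⟨k, hk, γ, rfl⟩
    exact ⟨k, hk, _, ⟨γ, rfl⟩, rfl⟩

theorem mem_spaceRPerp {Rs R' : V →ₗ.[ℝ] V} {X : V} :
    X ∈ spaceRPerp Rs R' ↔ ∃ k ∈ opKer R', ∃ γ : Rs.domain, X = k + (γ - Rs γ) := by
  rw [spaceRPerp, Submodule.mem_sup]
  constructor
  · rintro ⟨k, hk, _, ⟨γ, rfl⟩, rfl⟩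
    exact ⟨k, hk, γ, rfl⟩
  · rintro ⟨k, hk, γ, rfl⟩
    exact ⟨k, hk, _, ⟨γ, rfl⟩, rfl⟩

theorem graph_mem_spaceR {R R' : V →ₗ.[ℝ] V} (γ : R.domain) : (γ : V) + R γ ∈ spaceR R R' :=
  mem_spaceR.2 ⟨0, zero_mem _, γ, by simp⟩

theorem opKer_le_spaceR {R R' : V →ₗ.[ℝ] V} : opKer R' ≤ spaceR R R' := le_sup_left

/-- A decomposition splits an element into elements of the two subspaces. -/
theorem IsDecomposition.exists_add {R Rs R' : V →ₗ.[ℝ] V} {X : V} {αp αm : R.domain}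
    (h : IsDecomposition R Rs R' X αp αm) :
    ∃ αm' : Rs.domain, (αm' : V) = αm ∧ ∃ q ∈ spaceRPerp Rs R', ∃ k ∈ opKer R',
      q = k + (αm' - Rs αm') ∧ X = (αp + R αp) + q := by
  obtain ⟨αm', h1, k, hk, rfl⟩ := h
  refine ⟨αm', h1, _, mem_spaceRPerp.2 ⟨k, hk, αm', rfl⟩, k, hk, rfl, ?_⟩
  rw [← h1]
  abel

variable {form : LinearMap.BilinForm ℝ V} {G G' : Submodule ℝ V} {R Rs R' Rs' : V →ₗ.[ℝ] V}

namespace OperatorHypotheses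

theorem form_opKer_domain (hR : OperatorHypotheses form G G' R Rs R' Rs') {k x : V}
    (hk : k ∈ opKer R') (hx : x ∈ R.domain) : form k x = 0 :=
  ((hR.dom_eq_annihilator x).1 hx).2 k hk

theorem opKer_le (hR : OperatorHypotheses form G G' R Rs R' Rs') : opKer R ≤ G' := fun _ hx =>
  hR.dom_le (mem_opKer.1 hx).1

theorem opKer_le' (hR : OperatorHypotheses form G G' R Rs R' Rs') : opKer R' ≤ G := fun _ hx =>
  hR.dom_le' (mem_opKer.1 hx).1

theorem coe_adjoint_domain_mem (hR : OperatorHypotheses form G G' R Rs R' Rs') (γ : Rs.domain) :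
    (γ : V) ∈ R.domain := by
  rw [hR.dom_eq]
  exact γ.2

/-- The roles of `R` and `R'` can be exchanged. -/
theorem swap (hR : OperatorHypotheses form G G' R Rs R' Rs') :
    OperatorHypotheses form G' G R' Rs' R Rs where
  dom_le := hR.dom_le'
  im_le := hR.im_le'
  dom_le_adj := hR.dom_le_adj'
  im_le_adj := hR.im_le_adj'
  dom_le' := hR.dom_le
  im_le' := hR.im_le
  dom_le_adj' := hR.dom_le_adj
  im_le_adj' := hR.im_le_adj
  adjoint := hR.adjoint'
  adjoint' := hR.adjoint
  ker_eq := hR.ker_eq'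
  ker_eq' := hR.ker_eq
  im_le_dom := hR.im_le_dom'
  im_le_dom' := hR.im_le_dom
  left_inv := hR.right_inv
  right_inv := hR.left_inv
  dom_eq_annihilator := hR.dom_eq_annihilator'
  dom_eq_annihilator' := hR.dom_eq_annihilator
  dom_eq := hR.dom_eq'
  dom_eq' := hR.dom_eq
  nondegenerate := by
    intro x hx h
    rw [sup_comm] at hx h
    exact hR.nondegenerate x hx h

end OperatorHypotheses

/-- A symmetric nondegenerate form and two complementary isotropic subspaces. -/
structure IsLagrangianPair (form : LinearMap.BilinForm ℝ V) (G G' : Submodule ℝ V) : Prop where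
  symm : ∀ X Y, form X Y = form Y X
  nondegenerate : form.Nondegenerate
  isCompl : IsCompl G G'
  isotropic : ∀ X ∈ G, ∀ Y ∈ G, form X Y = 0
  isotropic' : ∀ X ∈ G', ∀ Y ∈ G', form X Y = 0

namespace IsLagrangianPair

theorem swap (hD : IsLagrangianPair form G G') : IsLagrangianPair form G' G :=
  ⟨hD.symm, hD.nondegenerate, hD.isCompl.symm, hD.isotropic', hD.isotropic⟩

theorem isRefl (hD : IsLagrangianPair form G G') : form.IsRefl := fun x y h => by
  rw [hD.symm, h]

theorem exists_add (hD : IsLagrangianPair form G G') (X : V) : ∃ g ∈ G, ∃ g' ∈ G', X = g + g' := by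
  have : X ∈ G ⊔ G' := by rw [hD.isCompl.sup_eq_top]; trivial
  obtain ⟨g, hg, g', hg', h⟩ := Submodule.mem_sup.1 this
  exact ⟨g, hg, g', hg', h.symm⟩

theorem add_eq_add (hD : IsLagrangianPair form G G') {g h g' h' : V} (hg : g ∈ G) (hh : h ∈ G)
    (hg' : g' ∈ G') (hh' : h' ∈ G') (e : g + g' = h + h') : g = h ∧ g' = h' := by
  have h1 : g - h = h' - g' := by
    rw [sub_eq_sub_iff_add_eq_add, e, add_comm]
  have h2 : g - h = 0 := (Submodule.disjoint_def.1 hD.isCompl.disjoint) _ (G.sub_mem hg hh)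
    (h1 ▸ G'.sub_mem hh' hg')
  exact ⟨sub_eq_zero.1 h2, (sub_eq_zero.1 (h1 ▸ h2)).symm⟩

end IsLagrangianPair

/-! ### Orthogonal complements and the quadratic form `K` -/

section

variable (hR : OperatorHypotheses form G G' R Rs R' Rs') (hD : IsLagrangianPair form G G')

include hR hD

/-- The kernel parts pair to zero by isotropy and by the annihilator condition; what remains is `⟨R
γ|γ'⟩ - ⟨γ|R^* γ'⟩`, which vanishes by adjointness. The minus sign in `spaceRPerp` is there for
this. -/
theorem form_spaceR_spaceRPerp {X Y : V} (hX : X ∈ spaceR R R') (hY : Y ∈ spaceRPerp Rs R') :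
    form X Y = 0 := by
  obtain ⟨k, hk, γ, rfl⟩ := mem_spaceR.1 hX
  obtain ⟨k', hk', γ', rfl⟩ := mem_spaceRPerp.1 hY
  have hγ' : (γ' : V) ∈ R.domain := hR.coe_adjoint_domain_mem γ'
  have e1 : form k k' = 0 := hD.isotropic _ (hR.opKer_le' hk) _ (hR.opKer_le' hk')
  have e2 : form k γ' = 0 := hR.form_opKer_domain hk hγ'
  have e3 : form k (Rs γ') = 0 :=
    hD.isotropic _ (hR.opKer_le' hk) _ (hR.im_le_adj (apply_mem_opIm Rs γ'))
  have e4 : form γ k' = 0 := by rw [hD.symm]; exact hR.form_opKer_domain hk' γ.2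
  have e5 : form γ γ' = 0 := hD.isotropic' _ (hR.dom_le γ.2) _ (hR.dom_le hγ')
  have e6 : form (R γ) k' = 0 :=
    hD.isotropic _ (hR.im_le (apply_mem_opIm R γ)) _ (hR.opKer_le' hk')
  have e7 : form (R γ) (Rs γ') = 0 :=
    hD.isotropic _ (hR.im_le (apply_mem_opIm R γ)) _ (hR.im_le_adj (apply_mem_opIm Rs γ'))
  have e8 : form γ (Rs γ') = form (R γ) γ' := by
    rw [hD.symm, hR.adjoint, hD.symm]
  simp only [map_add, map_sub, LinearMap.add_apply, e1, e2, e3, e4, e5, e6, e7, e8]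
  ring

theorem spaceF_isotropic {X Y : V} (hX : X ∈ spaceF R Rs R') (hY : Y ∈ spaceF R Rs R') :
    form X Y = 0 :=
  form_spaceR_spaceRPerp hR hD hX.1 hY.2

theorem spaceF_le_orthogonal : spaceF R Rs R' ≤ form.orthogonal (spaceF R Rs R') :=
  fun _ hX _ hY => spaceF_isotropic hR hD hY hX

variable [FiniteDimensional ℝ V]

/-- Orthogonality to `Ker R'` forces the `𝒢'`-component `g'` of a vector into `Dom R`. After
subtracting `g' - R^* g'`, a vector of `𝒢` orthogonal to `Dom R` is left, and such vectors form `Ker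
R'`. -/
theorem orthogonal_spaceR : form.orthogonal (spaceR R R') = spaceRPerp Rs R' := by
  refine le_antisymm (fun X hX => ?_) fun Y hY X hX => form_spaceR_spaceRPerp hR hD hX hY
  obtain ⟨g, hg, g', hg', rfl⟩ := hD.exists_add X
  have hX : ∀ Y ∈ spaceR R R', form Y (g + g') = 0 := hX
  have hdom : g' ∈ R.domain := by
    refine (hR.dom_eq_annihilator g').2 ⟨hg', fun k hk => ?_⟩
    have := hX k (opKer_le_spaceR hk)
    rwa [map_add, hD.isotropic _ (hR.opKer_le' hk) _ hg, zero_add] at this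
  have hdom' : g' ∈ Rs.domain := hR.dom_eq ▸ hdom
  have hq : g' - Rs ⟨g', hdom'⟩ ∈ spaceRPerp Rs R' :=
    mem_spaceRPerp.2 ⟨0, zero_mem _, ⟨g', hdom'⟩, by simp⟩
  have hyG : g + Rs ⟨g', hdom'⟩ ∈ G := G.add_mem hg (hR.im_le_adj (apply_mem_opIm Rs _))
  have hy : ∀ γ : R.domain, form γ (g + Rs ⟨g', hdom'⟩) = 0 := by
    intro γ
    have h1 := hX _ (graph_mem_spaceR γ)
    have h2 := form_spaceR_spaceRPerp hR hD (graph_mem_spaceR (R' := R') γ) hq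
    have h3 : form (R γ) (g + Rs ⟨g', hdom'⟩) = 0 :=
      hD.isotropic _ (hR.im_le (apply_mem_opIm R γ)) _ hyG
    simp only [map_add, map_sub, LinearMap.add_apply] at h1 h2 h3 ⊢
    linarith
  -- Biduality: any `z` orthogonal to `Ker R'` has its `𝒢'`-component in `Dom R`, and its
  -- `𝒢`-component pairs to zero with `𝒢`; so the vector is orthogonal to all of `(Ker R')^⊥`.
  have hk : g + Rs ⟨g', hdom'⟩ ∈ opKer R' := by
    rw [← LinearMap.BilinForm.orthogonal_orthogonal hD.nondegenerate hD.isRefl (opKer R')]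
    intro z hz
    obtain ⟨a, ha, a', ha', rfl⟩ := hD.exists_add z
    have hz : ∀ Y ∈ opKer R', form Y (a + a') = 0 := hz
    have hdom : a' ∈ R.domain := by
      refine (hR.dom_eq_annihilator a').2 ⟨ha', fun k hk => ?_⟩
      have := hz k hk
      rwa [map_add, hD.isotropic _ (hR.opKer_le' hk) _ ha, zero_add] at this
    change form (a + a') _ = 0
    rw [LinearMap.BilinForm.add_left, hD.isotropic _ ha _ hyG, hy ⟨a', hdom⟩, add_zero]
  exact mem_spaceRPerp.2 ⟨_, hk, ⟨g', hdom'⟩, by simp⟩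

theorem orthogonal_spaceF :
    form.orthogonal (spaceF R Rs R') = spaceR R R' ⊔ spaceRPerp Rs R' := by
  rw [← LinearMap.BilinForm.orthogonal_orthogonal hD.nondegenerate hD.isRefl
    (spaceR R R' ⊔ spaceRPerp Rs R')]
  -- It remains to see that `ℱ` is the orthogonal of the sum, that is, the intersection of the two
  -- orthogonals, each of which is the other space.
  congr 1
  have h1 := orthogonal_spaceR hR hD
  have h2 : form.orthogonal (spaceRPerp Rs R') = spaceR R R' := by
    rw [← h1, LinearMap.BilinForm.orthogonal_orthogonal hD.nondegenerate hD.isRefl]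
  ext X
  constructor
  · rintro ⟨hX, hX'⟩
    rw [← h2] at hX
    rw [← h1] at hX'
    intro Y hY
    obtain ⟨p, hp, q, hq, rfl⟩ := Submodule.mem_sup.1 hY
    have e1 : form p X = 0 := hX' p hp
    have e2 : form q X = 0 := hX q hq
    change form (p + q) X = 0
    rw [map_add, LinearMap.add_apply, e1, e2, add_zero]
  · intro hX
    refine ⟨?_, ?_⟩
    · rw [← h2]
      exact fun Y hY => hX Y (Submodule.mem_sup_right hY)
    · rw [← h1]
      exact fun Y hY => hX Y (Submodule.mem_sup_left hY)

theorem exists_isDecomposition {X : V} (hX : X ∈ form.orthogonal (spaceF R Rs R')) :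
    ∃ αp αm : R.domain, IsDecomposition R Rs R' X αp αm := by
  rw [orthogonal_spaceF hR hD] at hX
  obtain ⟨p, hp, q, hq, rfl⟩ := Submodule.mem_sup.1 hX
  obtain ⟨k, hk, γ, rfl⟩ := mem_spaceR.1 hp
  obtain ⟨k', hk', γ', rfl⟩ := mem_spaceRPerp.1 hq
  refine ⟨γ, ⟨γ', hR.coe_adjoint_domain_mem γ'⟩, γ', rfl, k + k', add_mem hk hk', ?_⟩
  simp only
  abel

omit [FiniteDimensional ℝ V] in
theorem form_self_graph (γ : R.domain) : form (γ + R γ) (γ + R γ) = 2 * form γ (R γ) := by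
  have e1 : form γ γ = 0 := hD.isotropic' _ (hR.dom_le γ.2) _ (hR.dom_le γ.2)
  have e2 : form (R γ) (R γ) = 0 := hD.isotropic _ (hR.im_le (apply_mem_opIm R γ)) _
    (hR.im_le (apply_mem_opIm R γ))
  simp only [map_add, LinearMap.add_apply, e1, e2, hD.symm (R γ) γ]
  ring

omit [FiniteDimensional ℝ V] in
theorem form_self_spaceR {p k : V} (hk : k ∈ opKer R') (γ : R.domain) (hp : p = k + (γ + R γ)) :
    form p p = 2 * form γ (R γ) := by
  have e1 : form k k = 0 := hD.isotropic _ (hR.opKer_le' hk) _ (hR.opKer_le' hk)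
  have e2 : form k (γ + R γ) = 0 := by
    rw [map_add, hR.form_opKer_domain hk γ.2, zero_add]
    exact hD.isotropic _ (hR.opKer_le' hk) _ (hR.im_le (apply_mem_opIm R γ))
  have e3 := hD.symm (γ + R γ) k
  have e4 := form_self_graph hR hD γ
  rw [hp, LinearMap.BilinForm.add_left, map_add (form k), map_add (form (γ + R γ)), e1, e3, e2, e4]
  ring

omit [FiniteDimensional ℝ V] in
theorem form_self_spaceRPerp {q k : V} (hk : k ∈ opKer R') (γ' : Rs.domain) (γ : R.domain)
    (e : (γ' : V) = γ) (hq : q = k + (γ' - Rs γ')) : form q q = -(2 * form γ (R γ)) := by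
  have hRs := hR.im_le_adj (apply_mem_opIm Rs γ')
  have hk' := hR.opKer_le' hk
  have e0 : form k k = 0 := hD.isotropic _ hk' _ hk'
  have e1 : form k γ' = 0 := by rw [e]; exact hR.form_opKer_domain hk γ.2
  have e2 : form k (Rs γ') = 0 := hD.isotropic _ hk' _ hRs
  have e3 : form (Rs γ') (Rs γ') = 0 := hD.isotropic _ hRs _ hRs
  have e4 : form γ' γ' = 0 := hD.isotropic' _ (hR.dom_le_adj γ'.2) _ (hR.dom_le_adj γ'.2)
  have e5 : form (Rs γ') γ' = form γ (R γ) := by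
    rw [e, hR.adjoint γ' γ, e]
  have e6 : form γ' (Rs γ') = form γ (R γ) := by rw [hD.symm, e5]
  have e7 : form γ' k = 0 := by rw [hD.symm, e1]
  have e8 : form (Rs γ') k = 0 := by rw [hD.symm, e2]
  rw [hq]
  simp only [map_add, map_sub, LinearMap.add_apply, LinearMap.sub_apply, e0, e1, e2, e3, e4, e5,
    e6, e7, e8]
  ring

omit [FiniteDimensional ℝ V] in
/-- The difference `⟨p | p⟩ - ⟨q | q⟩` depends only on `p + q`. -/
theorem form_sub_form_eq_of_add_eq {p q p' q' : V} (hp : p ∈ spaceR R R')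
    (hq : q ∈ spaceRPerp Rs R') (hp' : p' ∈ spaceR R R') (hq' : q' ∈ spaceRPerp Rs R')
    (h : p + q = p' + q') : form p p - form q q = form p' p' - form q' q' := by
  have hd : p' - p = q - q' := by
    rw [sub_eq_sub_iff_add_eq_add, ← h, add_comm]
  have hdR : p' - p ∈ spaceR R R' := sub_mem hp' hp
  have hdP : p' - p ∈ spaceRPerp Rs R' := hd ▸ sub_mem hq hq'
  have e1 : p' = p + (p' - p) := by abel
  have e2 : q' = q - (p' - p) := by rw [hd]; abel
  have e3 := form_spaceR_spaceRPerp hR hD hp hdP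
  have e4 := form_spaceR_spaceRPerp hR hD hdR hq
  have e5 := form_spaceR_spaceRPerp hR hD hdR hdP
  have e6 := hD.symm p (p' - p)
  have e7 := hD.symm q (p' - p)
  rw [e1, e2]
  set d := p' - p
  simp only [map_add, map_sub, LinearMap.add_apply, LinearMap.sub_apply,
    e3, e4, e5, ← e6, e7]
  ring

omit [FiniteDimensional ℝ V] in
-- The decomposition picked by `choose` and the given one split the same vector between the two
-- spaces. Both values are `⟨p|p⟩ - ⟨q|q⟩` for their splittings, and this difference depends only on
-- `p + q`.
theorem quadK_eq_of_isDecomposition {X : V} {αp αm : R.domain}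
    (h : IsDecomposition R Rs R' X αp αm) :
    quadK form R Rs R' X = 2 * form αp (R αp) + 2 * form αm (R αm) := by
  have hex : ∃ α : R.domain × R.domain, IsDecomposition R Rs R' X α.1 α.2 := ⟨(αp, αm), h⟩
  rw [quadK, dif_pos hex]
  obtain ⟨β, hβ, q, hq, k, hk, hqk, hX⟩ := h.exists_add
  obtain ⟨β', hβ', q', hq', k', hk', hqk', hX'⟩ := hex.choose_spec.exists_add
  have e1 := form_self_spaceRPerp hR hD hk β αm hβ hqk
  have e2 := form_self_spaceRPerp hR hD hk' β' hex.choose.2 hβ' hqk'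
  have e3 := form_self_graph hR hD αp
  have e4 := form_self_graph hR hD hex.choose.1
  have := form_sub_form_eq_of_add_eq hR hD (graph_mem_spaceR (R' := R') αp) hq
    (graph_mem_spaceR (R' := R') hex.choose.1) hq' (hX.symm.trans hX')
  rw [e1, e2, e3, e4] at this
  linarith

omit [FiniteDimensional ℝ V] in
-- The description of `K` free of the operators, from which its invariance and its continuity are
-- read off.
theorem quadK_add {p q : V} (hp : p ∈ spaceR R R') (hq : q ∈ spaceRPerp Rs R') :
    quadK form R Rs R' (p + q) = form p p - form q q := by
  obtain ⟨k, hk, γ, rfl⟩ := mem_spaceR.1 hp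
  obtain ⟨k', hk', γ', rfl⟩ := mem_spaceRPerp.1 hq
  have hd : IsDecomposition R Rs R' (k + (γ + R γ) + (k' + (γ' - Rs γ'))) γ
      ⟨γ', hR.coe_adjoint_domain_mem γ'⟩ := by
    refine ⟨γ', rfl, k + k', add_mem hk hk', ?_⟩
    simp only
    abel
  rw [quadK_eq_of_isDecomposition hR hD hd, form_self_spaceR hR hD hk γ rfl,
    form_self_spaceRPerp hR hD hk' γ' ⟨γ', hR.coe_adjoint_domain_mem γ'⟩ rfl rfl]
  ring

omit [FiniteDimensional ℝ V] in
/-- The quadratic form is invariant under isometries that preserve both subspaces and under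
translations along their intersection. -/
theorem quadK_map_add {A : V →ₗ[ℝ] V} (hA : ∀ X Y, form (A X) (A Y) = form X Y)
    (hAR : ∀ X ∈ spaceR R R', A X ∈ spaceR R R')
    (hAP : ∀ X ∈ spaceRPerp Rs R', A X ∈ spaceRPerp Rs R')
    {X Y : V} (hX : X ∈ spaceR R R' ⊔ spaceRPerp Rs R') (hY : Y ∈ spaceF R Rs R') :
    quadK form R Rs R' (Y + A X) = quadK form R Rs R' X := by
  obtain ⟨p, hp, q, hq, rfl⟩ := Submodule.mem_sup.1 hX
  rw [quadK_add hR hD hp hq, map_add, ← add_assoc, quadK_add hR hD (add_mem hY.1 (hAR p hp))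
    (hAP q hq), hA, LinearMap.BilinForm.add_left, map_add, map_add, hA,
    spaceF_isotropic hR hD hY hY, form_spaceR_spaceRPerp hR hD (hAR p hp) hY.2, hD.symm,
    form_spaceR_spaceRPerp hR hD (hAR p hp) hY.2]
  ring

end

/-! ### The intertwining identities and the subspaces preserved by the adjoint action -/

section Intertwining

variable {A : V →ₗ[ℝ] V} (hR : OperatorHypotheses form G G' R Rs R' Rs')
  (hD : IsLagrangianPair form G G')

include hR

/-- Since `J R = R`, the identity rearranges to `J A (γ + R γ) = R J' A (γ + R γ)`: the image of a
point of the graph is again on the graph, over `δ = J' A (γ + R γ)`. -/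
theorem map_graph (hc : IsCompl G G')
    (hA : IntertwiningIdentity (G.projection G' hc) (G'.projection G hc.symm) R A)
    (γ : R.domain) : ∃ δ : R.domain, A (γ + R γ) = δ + R δ := by
  obtain ⟨h1, h2, e⟩ := hA γ
  set J := G.projection G' hc
  set J' := G'.projection G hc.symm
  have hJ : ∀ x, J x + J' x = x := fun x => by
    simpa using LinearMap.congr_fun (Submodule.projection_add_projection_eq_id hc) x
  have hJR : ∀ x : R.domain, J (R x) = R x := fun x =>
    Submodule.projection_apply_of_mem_left hc (hR.im_le (apply_mem_opIm R x))
  refine ⟨⟨J' (A γ), h1⟩ + ⟨J' (A (R γ)), h2⟩, ?_⟩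
  rw [hJR] at e
  have e' : J (A γ) + J (A (R γ)) = R ⟨J' (A γ), h1⟩ + R ⟨J' (A (R γ)), h2⟩ := by
    rw [← e]; abel
  rw [map_add, R.map_add, ← e']
  conv_lhs => rw [← hJ (A γ), ← hJ (A (R γ))]
  simp only [Submodule.coe_add]
  abel

/-- The operator `R' R` is a projection of `Dom R` onto a complement of `Ker R`: `R` inverts `R'` on
`Im R`, so `R` kills `x - R' R x`. -/
theorem exists_opKer_add_opIm (x : R.domain) :
    ∃ k ∈ opKer R, ∃ y : R'.domain, (x : V) = k + R' y := by
  have h1 : R x ∈ R'.domain := hR.im_le_dom' (apply_mem_opIm R x)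
  have h2 : R' ⟨R x, h1⟩ ∈ R.domain := hR.im_le_dom (apply_mem_opIm R' _)
  have h3 : R ⟨R' ⟨R x, h1⟩, h2⟩ = R x :=
    hR.right_inv ⟨R x, h1⟩ (apply_mem_opIm R x) _ rfl
  refine ⟨x - R' ⟨R x, h1⟩, mem_opKer.2 ⟨sub_mem x.2 h2, ?_⟩, ⟨R x, h1⟩, by abel⟩
  have h4 := R.map_sub x ⟨_, h2⟩
  rw [h3, sub_self] at h4
  exact h4

/-- A map that intertwines both operators sends `Dom R` to `Dom R ⊕ Dom R'`. -/
theorem exists_map_eq_add (hc : IsCompl G G')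
    (hA : IntertwiningIdentity (G.projection G' hc) (G'.projection G hc.symm) R A)
    (hA' : IntertwiningIdentity (G'.projection G hc.symm) (G.projection G' hc) R' A)
    (γ : R.domain) : ∃ x ∈ R.domain, ∃ x' ∈ R'.domain, A γ = x + x' := by
  refine ⟨G'.projection G hc.symm (A γ), (hA γ).1, G.projection G' hc (A γ), ?_, ?_⟩
  -- The two parts of `γ` are treated differently: on `R' y` the domain clause of the identity for
  -- `R'` applies, and `k ∈ Ker R` is itself a point of the graph, so that `A k = δ + R δ` has its
  -- `𝒢`-part in `Im R`.
  · obtain ⟨k, hk, y, hy⟩ := exists_opKer_add_opIm hR γ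
    rw [hy, map_add, map_add]
    refine add_mem ?_ (hA' y).2.1
    obtain ⟨hk1, hk2⟩ := mem_opKer.1 hk
    obtain ⟨δ, hδ⟩ := map_graph hR hc hA ⟨k, hk1⟩
    rw [hk2, add_zero] at hδ
    rw [hδ, map_add, Submodule.projection_apply_eq_zero_iff hc |>.2 (hR.dom_le δ.2), zero_add,
      Submodule.projection_apply_of_mem_left hc (hR.im_le (apply_mem_opIm R δ))]
    exact hR.im_le_dom' (apply_mem_opIm R δ)
  · exact (Submodule.projection_add_projection_eq_self hc.symm _).symm

include hD in
-- The inverse `B` preserves `Dom R ⊕ Dom R' = (Ker R ⊕ Ker R')^⊥`, hence the isometry `A` preserves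
-- `Ker R ⊕ Ker R'`. Moreover `A n` lies on the graph of `R`, which meets this sum only in `Ker R`.
theorem map_opKer [FiniteDimensional ℝ V] (hc : IsCompl G G') {B : V →ₗ[ℝ] V}
    (hAB : ∀ X, A (B X) = X) (hiso : ∀ X Y, form (A X) (A Y) = form X Y)
    (hA : IntertwiningIdentity (G.projection G' hc) (G'.projection G hc.symm) R A)
    (hB : IntertwiningIdentity (G.projection G' hc) (G'.projection G hc.symm) R B)
    (hB' : IntertwiningIdentity (G'.projection G hc.symm) (G.projection G' hc) R' B)
    {n : V} (hn : n ∈ opKer R) : A n ∈ opKer R := by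
  have hdom : ∀ x ∈ R.domain, form n x = 0 := fun x hx =>
    hD.isotropic' _ (hR.opKer_le hn) _ (hR.dom_le hx)
  have hdom' : ∀ x ∈ R'.domain, form n x = 0 := fun x hx => hR.swap.form_opKer_domain hn hx
  have hmem : A n ∈ opKer R ⊔ opKer R' := by
    rw [← LinearMap.BilinForm.orthogonal_orthogonal hD.nondegenerate hD.isRefl
      (opKer R ⊔ opKer R')]
    intro y hy
    change form y (A n) = 0
    -- Moving `A` across the form, it is enough that `n` is orthogonal to `B y`, which lies in `Dom
    -- R ⊕ Dom R'`.
    rw [← hAB y, hiso, hD.symm]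
    obtain ⟨g, hg, g', hg', rfl⟩ := hD.exists_add y
    have hy1 : ∀ k ∈ opKer R, form k (g + g') = 0 := fun k hk => hy k (Submodule.mem_sup_left hk)
    have hy2 : ∀ k ∈ opKer R', form k (g + g') = 0 :=
      fun k hk => hy k (Submodule.mem_sup_right hk)
    have h1 : g' ∈ R.domain := by
      refine (hR.dom_eq_annihilator g').2 ⟨hg', fun k hk => ?_⟩
      have := hy2 k hk
      rwa [map_add, hD.isotropic _ (hR.opKer_le' hk) _ hg, zero_add] at this
    have h2 : g ∈ R'.domain := by
      refine (hR.dom_eq_annihilator' g).2 ⟨hg, fun k hk => ?_⟩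
      have := hy1 k hk
      rwa [map_add, hD.isotropic' _ (hR.opKer_le hk) _ hg', add_zero] at this
    obtain ⟨x, hx, x', hx', e⟩ := exists_map_eq_add hR hc hB hB' ⟨g', h1⟩
    obtain ⟨z', hz', z, hz, e'⟩ := exists_map_eq_add hR.swap hc.symm hB' hB ⟨g, h2⟩
    simp only at e e'
    rw [map_add, e, e', map_add, map_add, map_add, hdom x hx, hdom' x' hx', hdom z hz,
      hdom' z' hz']
    simp
  obtain ⟨hn1, hn2⟩ := mem_opKer.1 hn
  obtain ⟨δ, hδ⟩ := map_graph hR hc hA ⟨n, hn1⟩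
  rw [hn2, add_zero] at hδ
  simp only at hδ
  obtain ⟨m, hm, m', hm', e⟩ := Submodule.mem_sup.1 hmem
  rw [hδ] at e ⊢
  -- Comparing the `𝒢'`-components of `m + m' = δ + R δ` gives `δ = m ∈ Ker R`, so `R δ = 0`.
  have e1 := hD.swap.add_eq_add (hR.opKer_le hm) (hR.dom_le δ.2) (hR.opKer_le' hm')
    (hR.im_le (apply_mem_opIm R δ)) e
  obtain ⟨hm1, hm2⟩ := mem_opKer.1 hm
  have e2 : (⟨m, hm1⟩ : R.domain) = δ := Subtype.ext e1.1
  rw [e2] at hm2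
  rw [hm2, add_zero, ← e1.1]
  exact hm

theorem map_spaceR (hc : IsCompl G G')
    (hA : IntertwiningIdentity (G.projection G' hc) (G'.projection G hc.symm) R A)
    (hker : ∀ k ∈ opKer R', A k ∈ opKer R') {X : V} (hX : X ∈ spaceR R R') :
    A X ∈ spaceR R R' := by
  obtain ⟨k, hk, γ, rfl⟩ := mem_spaceR.1 hX
  obtain ⟨δ, hδ⟩ := map_graph hR hc hA γ
  rw [map_add, hδ]
  exact mem_spaceR.2 ⟨_, hker k hk, δ, rfl⟩

end Intertwining

section

variable (hR : OperatorHypotheses form G G' R Rs R' Rs') (hD : IsLagrangianPair form G G')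

include hR hD

theorem map_spaceRPerp [FiniteDimensional ℝ V] {A B : V →ₗ[ℝ] V} (hAB : ∀ X, A (B X) = X)
    (hiso : ∀ X Y, form (A X) (A Y) = form X Y) (hB : ∀ X ∈ spaceR R R', B X ∈ spaceR R R')
    {X : V} (hX : X ∈ spaceRPerp Rs R') : A X ∈ spaceRPerp Rs R' := by
  rw [← orthogonal_spaceR hR hD] at hX ⊢
  intro Y hY
  change form Y (A X) = 0
  rw [← hAB Y, hiso]
  exact hX _ (hB Y hY)

end

/-- The quadratic form is continuous on `ℱ^⊥`. -/
theorem continuousOn_quadK {E : Type*} [NormedAddCommGroup E] [NormedSpace ℝ E]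
    [FiniteDimensional ℝ E] {form : LinearMap.BilinForm ℝ E} {G G' : Submodule ℝ E}
    {R Rs R' Rs' : E →ₗ.[ℝ] E} (hR : OperatorHypotheses form G G' R Rs R' Rs')
    (hD : IsLagrangianPair form G G') :
    ContinuousOn (quadK form R Rs R') (form.orthogonal (spaceF R Rs R') : Set E) := by
  set P := spaceR R R' with hP
  set Q := spaceRPerp Rs R' with hQ
  let T : P × Q →ₗ[ℝ] (P ⊔ Q : Submodule ℝ E) :=
    LinearMap.codRestrict _ (P.subtype.coprod Q.subtype) fun x =>
      add_mem (Submodule.mem_sup_left x.1.2) (Submodule.mem_sup_right x.2.2)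
  have hT : LinearMap.range T = ⊤ := by
    rw [LinearMap.range_eq_top]
    rintro ⟨x, hx⟩
    obtain ⟨p, hp, q, hq, rfl⟩ := Submodule.mem_sup.1 hx
    exact ⟨(⟨p, hp⟩, ⟨q, hq⟩), rfl⟩
  -- A linear section of the addition map splits `x = p + q` with `p`, `q` linear in `x`; then `K`
  -- is a quadratic polynomial in `x`.
  obtain ⟨S, hS⟩ := T.exists_rightInverse_of_surjective hT
  let β : E →L[ℝ] E →L[ℝ] ℝ := LinearMap.toContinuousLinearMap
    ((LinearMap.toContinuousLinearMap : (E →ₗ[ℝ] ℝ) ≃ₗ[ℝ] (E →L[ℝ] ℝ)).toLinearMap ∘ₗ form)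
  rw [orthogonal_spaceF hR hD, continuousOn_iff_continuous_domRestrict]
  have hK : ∀ x : (P ⊔ Q : Submodule ℝ E), quadK form R Rs R' x =
      β (S x).1 (S x).1 - β (S x).2 (S x).2 := by
    intro x
    have h1 : ((S x).1 : E) + (S x).2 = x := congrArg Subtype.val (LinearMap.congr_fun hS x)
    rw [← h1, quadK_add hR hD (S x).1.2 (S x).2.2]
    rfl
  have hS' : Continuous S := S.continuous_of_finiteDimensional
  refine Continuous.congr (f := fun x : (P ⊔ Q : Submodule ℝ E) =>
    β (S x).1 (S x).1 - β (S x).2 (S x).2) ?_ fun x => (hK x).symm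
  fun_prop

end LinearAlgebra

/-! ### Logarithmic derivatives and the adjoint action in the chart at the identity -/

section LieGroups

open Filter Topology

variable {E : Type*} [NormedAddCommGroup E] [NormedSpace ℝ E]
  {D : Type*} [TopologicalSpace D] [ChartedSpace E D] [Group D]
  {S : Type*} [NormedAddCommGroup S] [NormedSpace ℝ S]

variable (E) in
/-- The coordinates in the preferred chart at the identity. -/
def toCoord (d : D) : E := extChartAt 𝓘(ℝ, E) (1 : D) d

variable (D) in
/-- The inverse of the preferred chart at the identity. -/
def ofCoord (y : E) : D := (extChartAt 𝓘(ℝ, E) (1 : D)).symm y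

theorem ofCoord_toCoord_one : ofCoord D (toCoord E (1 : D)) = 1 := extChartAt_to_inv (1 : D)

theorem eventually_ofCoord_toCoord : ∀ᶠ d : D in 𝓝 1, ofCoord D (toCoord E d) = d := by
  filter_upwards [extChartAt_source_mem_nhds (I := 𝓘(ℝ, E)) (1 : D)] with d hd
  exact (extChartAt 𝓘(ℝ, E) (1 : D)).left_inv hd

theorem eventually_mem_target :
    ∀ᶠ y : E in 𝓝 (toCoord E (1 : D)), y ∈ (extChartAt 𝓘(ℝ, E) (1 : D)).target :=
  extChartAt_target_mem_nhds (1 : D)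

theorem eventually_toCoord_ofCoord :
    ∀ᶠ y : E in 𝓝 (toCoord E (1 : D)), toCoord E (ofCoord D y) = y := by
  filter_upwards [eventually_mem_target] with y hy
  exact (extChartAt 𝓘(ℝ, E) (1 : D)).right_inv hy

theorem contMDiffAt_toCoord [IsManifold 𝓘(ℝ, E) ∞ D] {d : D} (hd : d = 1) :
    ContMDiffAt 𝓘(ℝ, E) 𝓘(ℝ, E) ∞ (toCoord E : D → E) d := by
  subst hd
  exact contMDiffAt_extChartAt

theorem contMDiffAt_ofCoord [IsManifold 𝓘(ℝ, E) ∞ D] {y : E}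
    (hy : y ∈ (extChartAt 𝓘(ℝ, E) (1 : D)).target) :
    ContMDiffAt 𝓘(ℝ, E) 𝓘(ℝ, E) ∞ (ofCoord D) y :=
  (contMDiffOn_extChartAt_symm (1 : D)).contMDiffAt (extChartAt_target_mem_nhds' hy)

theorem toCoord_one_mem_target :
    toCoord E (1 : D) ∈ (extChartAt 𝓘(ℝ, E) (1 : D)).target := mem_extChartAt_target 1

theorem contDiffAt_toCoord_comp [IsManifold 𝓘(ℝ, E) ∞ D] {v : S → D} {x : S}
    (hv : ContMDiffAt 𝓘(ℝ, S) 𝓘(ℝ, E) ∞ v x) (hx : v x = 1) :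
    ContDiffAt ℝ ∞ (fun y => toCoord E (v y)) x :=
  ((contMDiffAt_toCoord hx).comp x hv).contDiffAt

/-- The derivative is expressed in the preferred chart at `v x`. For maps passing through `1` this
is the fixed chart `toCoord`, so that logarithmic derivatives become ordinary ones. -/
theorem mfderiv_eq_fderiv_toCoord {v : S → D} {x : S}
    (hv : MDifferentiableAt 𝓘(ℝ, S) 𝓘(ℝ, E) v x) (hx : v x = 1) :
    (mfderiv 𝓘(ℝ, S) 𝓘(ℝ, E) v x : S →L[ℝ] E) = fderiv ℝ (fun y => toCoord E (v y)) x := by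
  refine Eq.trans (if_pos hv) ?_
  change fderivWithin ℝ (writtenInExtChartAt 𝓘(ℝ, S) 𝓘(ℝ, E) x v) (Set.range 𝓘(ℝ, S))
    (extChartAt 𝓘(ℝ, S) x x) = _
  simp only [mfld_simps, fderivWithin_univ, writtenInExtChartAt, hx]
  rfl

section Maps

variable {E₁ : Type*} [NormedAddCommGroup E₁] [NormedSpace ℝ E₁]
  {F : Type*} [TopologicalSpace F] [ChartedSpace E₁ F] [Group F]

/-- The expression in the charts at the identity of a map between groups. -/
def coordMap (φ : F → D) (y : E₁) : E := toCoord E (φ (ofCoord F y))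

variable (E E₁) in
/-- The derivative at the identity of a map between groups, as a map between the model spaces. -/
def derivOne (φ : F → D) : E₁ →L[ℝ] E := mfderiv 𝓘(ℝ, E₁) 𝓘(ℝ, E) φ 1

variable [IsManifold 𝓘(ℝ, E) ∞ D] [IsManifold 𝓘(ℝ, E₁) ∞ F]

theorem contDiffAt_coordMap {φ : F → D} (hφ : ContMDiffAt 𝓘(ℝ, E₁) 𝓘(ℝ, E) ∞ φ 1)
    (h1 : φ 1 = 1) : ContDiffAt ℝ ∞ (coordMap φ : E₁ → E) (toCoord E₁ (1 : F)) := by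
  refine contDiffAt_toCoord_comp (v := fun y : E₁ => φ (ofCoord F y)) ?_ ?_
  · refine ContMDiffAt.comp (g := φ) _ ?_ (contMDiffAt_ofCoord toCoord_one_mem_target)
    rwa [ofCoord_toCoord_one]
  · rw [ofCoord_toCoord_one, h1]

omit [IsManifold 𝓘(ℝ, E) ∞ D] [IsManifold 𝓘(ℝ, E₁) ∞ F] in
theorem derivOne_eq_fderiv_coordMap {φ : F → D} (hφ : ContMDiffAt 𝓘(ℝ, E₁) 𝓘(ℝ, E) ∞ φ 1)
    (h1 : φ 1 = 1) : derivOne E E₁ φ = fderiv ℝ (coordMap φ) (toCoord E₁ (1 : F)) := by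
  refine Eq.trans (if_pos (hφ.mdifferentiableAt (by simp))) ?_
  change fderivWithin ℝ (writtenInExtChartAt 𝓘(ℝ, E₁) 𝓘(ℝ, E) (1 : F) φ) (Set.range 𝓘(ℝ, E₁))
    (extChartAt 𝓘(ℝ, E₁) (1 : F) (1 : F)) = _
  simp only [mfld_simps, fderivWithin_univ, writtenInExtChartAt, h1]
  rfl

theorem fderiv_toCoord_comp {φ : F → D} (hφ : ContMDiffAt 𝓘(ℝ, E₁) 𝓘(ℝ, E) ∞ φ 1)
    (h1 : φ 1 = 1) {v : S → F} {x : S} (hv : ContMDiffAt 𝓘(ℝ, S) 𝓘(ℝ, E₁) ∞ v x) (hx : v x = 1) :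
    fderiv ℝ (fun y => toCoord E (φ (v y))) x =
      derivOne E E₁ φ ∘L fderiv ℝ (fun y => toCoord E₁ (v y)) x := by
  have e : (fun y => toCoord E (φ (v y))) =ᶠ[𝓝 x]
      (coordMap φ : E₁ → E) ∘ fun y => toCoord E₁ (v y) := by
    have h : Tendsto v (𝓝 x) (𝓝 1) := by
      have := hv.continuousAt
      rwa [ContinuousAt, hx] at this
    filter_upwards [h.eventually (eventually_ofCoord_toCoord (E := E₁))] with y hy
    simp only [Function.comp_apply, coordMap, hy]
  rw [e.fderiv_eq, derivOne_eq_fderiv_coordMap hφ h1, ← hx]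
  refine fderiv_comp x ?_ ((contDiffAt_toCoord_comp hv hx).differentiableAt (by simp))
  rw [hx]
  exact (contDiffAt_coordMap hφ h1).differentiableAt (by simp)

/-- The chain rule at the identity. -/
theorem derivOne_comp {E₂ : Type*} [NormedAddCommGroup E₂] [NormedSpace ℝ E₂]
    {F₂ : Type*} [TopologicalSpace F₂] [ChartedSpace E₂ F₂] [Group F₂]
    [IsManifold 𝓘(ℝ, E₂) ∞ F₂]
    {φ : F → D} {ψ : F₂ → F} (hφ : ContMDiffAt 𝓘(ℝ, E₁) 𝓘(ℝ, E) ∞ φ 1) (hφ1 : φ 1 = 1)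
    (hψ : ContMDiffAt 𝓘(ℝ, E₂) 𝓘(ℝ, E₁) ∞ ψ 1) (hψ1 : ψ 1 = 1) :
    derivOne E E₂ (fun y => φ (ψ y)) = derivOne E E₁ φ ∘L derivOne E₁ E₂ ψ := by
  have h : ContMDiffAt 𝓘(ℝ, E₂) 𝓘(ℝ, E) ∞ (fun y => φ (ψ y)) 1 := by
    refine ContMDiffAt.comp (g := φ) 1 ?_ hψ
    rwa [hψ1]
  have h' : ContMDiffAt 𝓘(ℝ, E₂) 𝓘(ℝ, E₁) ∞ (fun y => ψ (ofCoord F₂ y)) (toCoord E₂ (1 : F₂)) := by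
    refine ContMDiffAt.comp (g := ψ) _ ?_ (contMDiffAt_ofCoord toCoord_one_mem_target)
    rwa [ofCoord_toCoord_one]
  rw [derivOne_eq_fderiv_coordMap h (by rw [hψ1, hφ1]), derivOne_eq_fderiv_coordMap hψ hψ1]
  exact fderiv_toCoord_comp (v := fun y => ψ (ofCoord F₂ y)) hφ hφ1 h'
    (by rw [ofCoord_toCoord_one, hψ1])

end Maps

variable (E D) in
/-- The multiplication of the group in the chart at the identity. -/
def coordMul (p : E × E) : E := toCoord E (ofCoord D p.1 * ofCoord D p.2)

variable [LieGroup 𝓘(ℝ, E) ∞ D]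

theorem contDiffAt_coordMul :
    ContDiffAt ℝ ∞ (coordMul E D) (toCoord E (1 : D), toCoord E (1 : D)) := by
  have : IsManifold 𝓘(ℝ, E) ∞ D := LieGroup.toContMDiffMul.toIsManifold
  refine contDiffAt_toCoord_comp (v := fun p : E × E => ofCoord D p.1 * ofCoord D p.2) ?_ ?_
  · refine ContMDiffAt.mul ?_ ?_
    · exact ContMDiffAt.comp (g := ofCoord D) (toCoord E (1 : D), toCoord E (1 : D))
        (contMDiffAt_ofCoord toCoord_one_mem_target) contDiffAt_fst.contMDiffAt
    · exact ContMDiffAt.comp (g := ofCoord D) (toCoord E (1 : D), toCoord E (1 : D))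
        (contMDiffAt_ofCoord toCoord_one_mem_target) contDiffAt_snd.contMDiffAt
  · simp [ofCoord_toCoord_one]

/-- On each of the two axes through the identity the multiplication is the identity map, which
determines its differential there. -/
theorem fderiv_coordMul_one (w : E × E) :
    fderiv ℝ (coordMul E D) (toCoord E (1 : D), toCoord E (1 : D)) w = w.1 + w.2 := by
  set c := toCoord E (1 : D) with hc
  have hd : DifferentiableAt ℝ (coordMul E D) (c, c) :=
    contDiffAt_coordMul.differentiableAt (by simp)
  have e1 : fderiv ℝ (coordMul E D) (c, c) ∘L .inl ℝ E E = .id ℝ E := by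
    have h : HasFDerivAt (fun y : E => (y, c)) (ContinuousLinearMap.inl ℝ E E) c :=
      hasFDerivAt_prodMk_left c c
    have h2 := HasFDerivAt.comp (f := fun y : E => (y, c)) c hd.hasFDerivAt h
    refine h2.unique ((hasFDerivAt_id c).congr_of_eventuallyEq ?_)
    filter_upwards [eventually_toCoord_ofCoord (D := D)] with y hy
    simp [coordMul, hc, ofCoord_toCoord_one, hy]
  have e2 : fderiv ℝ (coordMul E D) (c, c) ∘L .inr ℝ E E = .id ℝ E := by
    have h : HasFDerivAt (fun y : E => (c, y)) (ContinuousLinearMap.inr ℝ E E) c :=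
      hasFDerivAt_prodMk_right c c
    have h2 := HasFDerivAt.comp (f := fun y : E => (c, y)) c hd.hasFDerivAt h
    refine h2.unique ((hasFDerivAt_id c).congr_of_eventuallyEq ?_)
    filter_upwards [eventually_toCoord_ofCoord (D := D)] with y hy
    simp [coordMul, hc, ofCoord_toCoord_one, hy]
  have h1 := DFunLike.congr_fun e1 w.1
  have h2 := DFunLike.congr_fun e2 w.2
  simp only [ContinuousLinearMap.comp_apply, ContinuousLinearMap.inl_apply,
    ContinuousLinearMap.inr_apply, ContinuousLinearMap.id_apply] at h1 h2
  have : w = (w.1, 0) + (0, w.2) := by simp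
  rw [this, map_add, h1, h2]
  simp

theorem fderiv_toCoord_mul {v w : S → D} {x : S} (hv : ContMDiffAt 𝓘(ℝ, S) 𝓘(ℝ, E) ∞ v x)
    (hw : ContMDiffAt 𝓘(ℝ, S) 𝓘(ℝ, E) ∞ w x) (hvx : v x = 1) (hwx : w x = 1) :
    fderiv ℝ (fun y => toCoord E (v y * w y)) x =
      fderiv ℝ (fun y => toCoord E (v y)) x + fderiv ℝ (fun y => toCoord E (w y)) x := by
  have : IsManifold 𝓘(ℝ, E) ∞ D := LieGroup.toContMDiffMul.toIsManifold
  have tend : ∀ {v : S → D}, ContMDiffAt 𝓘(ℝ, S) 𝓘(ℝ, E) ∞ v x → v x = 1 →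
      Tendsto v (𝓝 x) (𝓝 1) := by
    intro v hv hx
    have := hv.continuousAt
    rwa [ContinuousAt, hx] at this
  have e : (fun y => toCoord E (v y * w y)) =ᶠ[𝓝 x]
      coordMul E D ∘ fun y => (toCoord E (v y), toCoord E (w y)) := by
    filter_upwards [(tend hv hvx).eventually (eventually_ofCoord_toCoord (E := E)),
      (tend hw hwx).eventually (eventually_ofCoord_toCoord (E := E))] with y h1 h2
    simp only [Function.comp_apply, coordMul, h1, h2]
  have hv' := (contDiffAt_toCoord_comp hv hvx).differentiableAt (by simp)
  have hw' := (contDiffAt_toCoord_comp hw hwx).differentiableAt (by simp)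
  have hm : HasFDerivAt (coordMul E D) (fderiv ℝ (coordMul E D)
      (toCoord E (1 : D), toCoord E (1 : D))) (toCoord E (v x), toCoord E (w x)) := by
    rw [hvx, hwx]
    exact (contDiffAt_coordMul.differentiableAt (by simp)).hasFDerivAt
  rw [e.fderiv_eq, (hm.comp x (hv'.hasFDerivAt.prodMk hw'.hasFDerivAt)).fderiv]
  ext a
  simp [fderiv_coordMul_one]

variable (E) in
/-- The logarithmic derivative, as a map between the model spaces. -/
def rightDeriv (u : S → D) (x : S) : S →L[ℝ] E := rightLogDeriv E u x

variable (E) in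
/-- The adjoint action, as a map on the model space. -/
def adjoint (g : D) : E →L[ℝ] E := Ad E g

theorem rightDeriv_eq_fderiv {u : S → D} {x : S} (hu : ContMDiffAt 𝓘(ℝ, S) 𝓘(ℝ, E) ∞ u x) :
    rightDeriv E u x = fderiv ℝ (fun y => toCoord E (u y * (u x)⁻¹)) x :=
  mfderiv_eq_fderiv_toCoord ((hu.mul contMDiffAt_const).mdifferentiableAt (by simp)) (by simp)

omit [LieGroup 𝓘(ℝ, E) ∞ D] in
theorem rightDeriv_congr {u v : S → D} {x : S} (h : u =ᶠ[𝓝 x] v) :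
    rightDeriv E u x = rightDeriv E v x := by
  have e : (fun y => u y * (u x)⁻¹) =ᶠ[𝓝 x] fun y => v y * (v x)⁻¹ := by
    filter_upwards [h] with y hy
    rw [hy, h.self_of_nhds]
  exact e.mfderiv_eq

theorem rightDeriv_const (d : D) (x : S) : rightDeriv E (fun _ : S => d) x = 0 := by
  rw [rightDeriv_eq_fderiv contMDiffAt_const]
  simp

theorem rightDeriv_comp {S' : Type*} [NormedAddCommGroup S'] [NormedSpace ℝ S'] {u : S → D}
    {g : S' → S} {x : S'} (hu : ContMDiffAt 𝓘(ℝ, S) 𝓘(ℝ, E) ∞ u (g x)) (hg : ContDiffAt ℝ ∞ g x) :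
    rightDeriv E (fun y => u (g y)) x = rightDeriv E u (g x) ∘L fderiv ℝ g x := by
  have : IsManifold 𝓘(ℝ, E) ∞ D := LieGroup.toContMDiffMul.toIsManifold
  have hc : ContMDiffAt 𝓘(ℝ, S') 𝓘(ℝ, E) ∞ (fun y => u (g y)) x := hu.comp x hg.contMDiffAt
  rw [rightDeriv_eq_fderiv hc, rightDeriv_eq_fderiv hu]
  refine fderiv_comp (g := fun y => toCoord E (u y * (u (g x))⁻¹)) x ?_
    (hg.differentiableAt (by simp))
  exact (contDiffAt_toCoord_comp (hu.mul contMDiffAt_const) (by simp)).differentiableAt (by simp)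

theorem contMDiff_conj (g : D) : ContMDiff 𝓘(ℝ, E) 𝓘(ℝ, E) ∞ fun y : D => g * y * g⁻¹ :=
  (contMDiff_const.mul contMDiff_id).mul contMDiff_const

/-- The translated product is `u y (u x)⁻¹` times the conjugate by `u x` of `v y (v x)⁻¹`. Both
factors pass through `1`, where the multiplication linearizes to addition and the conjugation to
`Ad`. -/
theorem rightDeriv_mul {u v : S → D} {x : S} (hu : ContMDiffAt 𝓘(ℝ, S) 𝓘(ℝ, E) ∞ u x)
    (hv : ContMDiffAt 𝓘(ℝ, S) 𝓘(ℝ, E) ∞ v x) :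
    rightDeriv E (fun y => u y * v y) x =
      rightDeriv E u x + adjoint E (u x) ∘L rightDeriv E v x := by
  have : IsManifold 𝓘(ℝ, E) ∞ D := LieGroup.toContMDiffMul.toIsManifold
  have huv : ContMDiffAt 𝓘(ℝ, S) 𝓘(ℝ, E) ∞ (fun y => u y * v y) x := hu.mul hv
  rw [rightDeriv_eq_fderiv huv, rightDeriv_eq_fderiv hu, rightDeriv_eq_fderiv hv]
  have e : (fun y => toCoord E (u y * v y * (u x * v x)⁻¹)) = fun y =>
      toCoord E ((u y * (u x)⁻¹) * (u x * (v y * (v x)⁻¹) * (u x)⁻¹)) := by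
    ext y
    congr 1
    group
  have h1 : ContMDiffAt 𝓘(ℝ, S) 𝓘(ℝ, E) ∞ (fun y => v y * (v x)⁻¹) x := hv.mul contMDiffAt_const
  have h2 : ContMDiffAt 𝓘(ℝ, S) 𝓘(ℝ, E) ∞ (fun y => u x * (v y * (v x)⁻¹) * (u x)⁻¹) x :=
    (contMDiff_conj (u x)).contMDiffAt.comp x h1
  have h3 : ContMDiffAt 𝓘(ℝ, S) 𝓘(ℝ, E) ∞ (fun y => u y * (u x)⁻¹) x := hu.mul contMDiffAt_const
  rw [e, fderiv_toCoord_mul h3 h2 (by simp) (by simp)]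
  congr 1
  exact fderiv_toCoord_comp (φ := fun y => u x * y * (u x)⁻¹) (contMDiff_conj (u x)).contMDiffAt
    (by simp) h1 (by simp)

section Hom

variable {E₁ : Type*} [NormedAddCommGroup E₁] [NormedSpace ℝ E₁]
  {F : Type*} [TopologicalSpace F] [ChartedSpace E₁ F] [Group F] [LieGroup 𝓘(ℝ, E₁) ∞ F]

theorem rightDeriv_hom {ι : F →* D} (hι : ContMDiff 𝓘(ℝ, E₁) 𝓘(ℝ, E) ∞ ι) {u : S → F} {x : S}
    (hu : ContMDiffAt 𝓘(ℝ, S) 𝓘(ℝ, E₁) ∞ u x) :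
    rightDeriv E (fun y => ι (u y)) x = derivOne E E₁ ι ∘L rightDeriv E₁ u x := by
  have : IsManifold 𝓘(ℝ, E) ∞ D := LieGroup.toContMDiffMul.toIsManifold
  have : IsManifold 𝓘(ℝ, E₁) ∞ F := LieGroup.toContMDiffMul.toIsManifold
  have hc : ContMDiffAt 𝓘(ℝ, S) 𝓘(ℝ, E) ∞ (fun y => ι (u y)) x := hι.contMDiffAt.comp x hu
  have h1 : ContMDiffAt 𝓘(ℝ, S) 𝓘(ℝ, E₁) ∞ (fun y => u y * (u x)⁻¹) x := hu.mul contMDiffAt_const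
  rw [rightDeriv_eq_fderiv hc, rightDeriv_eq_fderiv hu, ← fderiv_toCoord_comp hι.contMDiffAt
    (map_one ι) h1 (by simp)]
  simp only [map_mul, map_inv]

theorem adjoint_hom {ι : F →* D} (hι : ContMDiff 𝓘(ℝ, E₁) 𝓘(ℝ, E) ∞ ι) (f : F) (Y : E₁) :
    adjoint E (ι f) (derivOne E E₁ ι Y) = derivOne E E₁ ι (adjoint E₁ f Y) := by
  have : IsManifold 𝓘(ℝ, E) ∞ D := LieGroup.toContMDiffMul.toIsManifold
  have : IsManifold 𝓘(ℝ, E₁) ∞ F := LieGroup.toContMDiffMul.toIsManifold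
  have h1 := derivOne_comp (contMDiff_conj (E := E) (ι f)).contMDiffAt (by simp)
    hι.contMDiffAt (map_one ι)
  have h2 := derivOne_comp hι.contMDiffAt (map_one ι)
    (contMDiff_conj (E := E₁) f).contMDiffAt (by simp)
  have e : (fun y => ι (f * y * f⁻¹)) = fun y => ι f * ι y * (ι f)⁻¹ := by
    ext y; simp
  rw [e, h1] at h2
  exact DFunLike.congr_fun h2 Y

end Hom

theorem adjoint_mul (g h : D) (X : E) : adjoint E (g * h) X = adjoint E g (adjoint E h X) := by
  have : IsManifold 𝓘(ℝ, E) ∞ D := LieGroup.toContMDiffMul.toIsManifold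
  have e : (fun y : D => g * (h * y * h⁻¹) * g⁻¹) = fun y => g * h * y * (g * h)⁻¹ := by
    ext y
    group
  have h1 := derivOne_comp (contMDiff_conj (E := E) g).contMDiffAt (by simp)
    (contMDiff_conj (E := E) h).contMDiffAt (by simp)
  rw [e] at h1
  exact DFunLike.congr_fun h1 X

omit [LieGroup 𝓘(ℝ, E) ∞ D] in
theorem adjoint_one (X : E) : adjoint E (1 : D) X = X := by
  have e : (fun y : D => 1 * y * 1⁻¹) = id := by ext y; simp
  change derivOne E E (fun y : D => 1 * y * 1⁻¹) X = X
  rw [e]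
  exact DFunLike.congr_fun (mfderiv_id (I := 𝓘(ℝ, E)) (x := (1 : D))) X

theorem adjoint_inv_apply (g : D) (X : E) : adjoint E g (adjoint E g⁻¹ X) = X := by
  rw [← adjoint_mul, mul_inv_cancel, adjoint_one]

end LieGroups

/-! ### The Lie bracket in coordinates and the Maurer-Cartan equation -/

section MaurerCartan

open Filter Topology

variable {E : Type*} [NormedAddCommGroup E] [NormedSpace ℝ E]
  {D : Type*} [TopologicalSpace D] [ChartedSpace E D] [Group D]
  {S : Type*} [NormedAddCommGroup S] [NormedSpace ℝ S]

theorem two_le_infty : minSmoothness ℝ 2 ≤ (∞ : WithTop ℕ∞) := by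
  simpa using (ENat.LEInfty.out : (2 : WithTop ℕ∞) ≤ ∞)

variable (E D) in
/-- The Lie bracket on the model space. -/
def bracketOne (X Y : E) : E :=
  @Bracket.bracket (GroupLieAlgebra 𝓘(ℝ, E) D) (GroupLieAlgebra 𝓘(ℝ, E) D) _ X Y

variable [LieGroup 𝓘(ℝ, E) ∞ D]

omit [LieGroup 𝓘(ℝ, E) ∞ D] in
theorem hasMFDerivAt_comp_toCoord [IsManifold 𝓘(ℝ, E) ∞ D] {m : E → E} {L : E →L[ℝ] E}
    (hm : HasFDerivAt m L (toCoord E (1 : D))) :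
    HasMFDerivAt 𝓘(ℝ, E) 𝓘(ℝ, E) (fun g : D => m (toCoord E g)) 1 L := by
  have : IsManifold 𝓘(ℝ, E) 1 D := IsManifold.of_le (n := ∞) (by simp)
  have h := (mdifferentiableAt_extChartAt (I := 𝓘(ℝ, E)) (mem_chart_source E (1 : D))).hasMFDerivAt
  rw [mfderiv_extChartAt_self] at h
  exact HasMFDerivAt.comp (1 : D) hm.hasMFDerivAt h

/-- An invariant vector field in the chart at the identity. -/
theorem eventually_mpullback_mulInvariantVectorField (X : E) :
    ∀ᶠ y in 𝓝 (toCoord E (1 : D)),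
      (VectorField.mpullbackWithin 𝓘(ℝ, E) 𝓘(ℝ, E) (extChartAt 𝓘(ℝ, E) (1 : D)).symm
        (mulInvariantVectorField (X : GroupLieAlgebra 𝓘(ℝ, E) D)) (Set.range 𝓘(ℝ, E)) y : E) =
      fderiv ℝ (coordMul E D) (y, toCoord E (1 : D)) (0, X) := by
  have : IsManifold 𝓘(ℝ, E) ∞ D := LieGroup.toContMDiffMul.toIsManifold
  have : IsManifold 𝓘(ℝ, E) 1 D := IsManifold.of_le (n := ∞) (by simp)
  set c := toCoord E (1 : D) with hc
  have hdiff : ∀ᶠ y in 𝓝 c, DifferentiableAt ℝ (coordMul E D) (y, c) := by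
    have h1 : ∀ᶠ p in 𝓝 (c, c), ContDiffAt ℝ 1 (coordMul E D) p :=
      (contDiffAt_coordMul.of_le (by simp)).eventually (by simp)
    have h2 : Tendsto (fun y : E => (y, c)) (𝓝 c) (𝓝 (c, c)) :=
      (continuous_id.prodMk continuous_const).tendsto c
    filter_upwards [h2.eventually h1] with y hy
    exact hy.differentiableAt (by simp)
  filter_upwards [eventually_mem_target (D := D), hdiff] with y hy hyd
  have hinv := isInvertible_mfderivWithin_extChartAt_symm (I := 𝓘(ℝ, E)) hy
  -- The pull-back applies the inverse of the derivative of the chart inverse, so the claim becomes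
  -- that this derivative sends the right-hand side to the invariant field at `ofCoord D y`. It
  -- follows by differentiating the left translation written as `ofCoord D ∘ φ`.
  refine (hinv.inverse_apply_eq).2 ?_
  let φ : D → E := fun g => coordMul E D (y, toCoord E g)
  let A : E → E →L[ℝ] E := fun z => mfderiv 𝓘(ℝ, E) 𝓘(ℝ, E) (ofCoord D) z
  have hφ1 : φ 1 = y := by
    simp only [φ, coordMul, ofCoord_toCoord_one, mul_one]
    exact (extChartAt 𝓘(ℝ, E) (1 : D)).right_inv hy
  have hφ : HasMFDerivAt 𝓘(ℝ, E) 𝓘(ℝ, E) φ 1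
      ((fderiv ℝ (coordMul E D) (y, c) ∘L ContinuousLinearMap.inr ℝ E E : E →L[ℝ] E)) := by
    have h2 : HasFDerivAt (fun z : E => coordMul E D (y, z))
        (fderiv ℝ (coordMul E D) (y, c) ∘L ContinuousLinearMap.inr ℝ E E) c :=
      HasFDerivAt.comp (f := fun z : E => (y, z)) c hyd.hasFDerivAt (hasFDerivAt_prodMk_right y c)
    exact hasMFDerivAt_comp_toCoord h2
  have hsymm : MDifferentiableAt 𝓘(ℝ, E) 𝓘(ℝ, E) (ofCoord D) y :=
    (contMDiffAt_ofCoord hy).mdifferentiableAt (by simp)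
  have e : (fun g : D => ofCoord D y * g) =ᶠ[𝓝 1] ofCoord D ∘ φ := by
    have hs : (extChartAt 𝓘(ℝ, E) (1 : D)).source ∈ 𝓝 (ofCoord D y) :=
      extChartAt_source_mem_nhds' ((extChartAt 𝓘(ℝ, E) (1 : D)).map_target hy)
    have ht : Tendsto (fun g : D => ofCoord D y * g) (𝓝 1) (𝓝 (ofCoord D y)) := by
      have := (contMDiff_mul_left (I := 𝓘(ℝ, E)) (n := ∞) (a := ofCoord D y)).continuous.tendsto 1
      rwa [mul_one] at this
    filter_upwards [ht hs, eventually_ofCoord_toCoord (E := E) (D := D)] with g hg hg'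
    simp only [Function.comp_apply, φ, coordMul, hg']
    exact ((extChartAt 𝓘(ℝ, E) (1 : D)).left_inv hg).symm
  have h3 := mfderiv_comp_of_eq hsymm hφ.mdifferentiableAt hφ1
  have h4 : ((mfderiv 𝓘(ℝ, E) 𝓘(ℝ, E) (fun g : D => ofCoord D y * g) 1 : E →L[ℝ] E)) =
      A (φ 1) ∘L (fderiv ℝ (coordMul E D) (y, c) ∘L ContinuousLinearMap.inr ℝ E E) := by
    refine Eq.trans e.mfderiv_eq (h3.trans ?_)
    rw [hφ.mfderiv]
    rfl
  have h5 : (mfderivWithin 𝓘(ℝ, E) 𝓘(ℝ, E) (ofCoord D) (Set.range 𝓘(ℝ, E)) y : E →L[ℝ] E) =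
      A y := by
    simp only [A, modelWithCornersSelf_coe, Set.range_id, mfderivWithin_univ]
  rw [hφ1] at h4
  refine (DFunLike.congr_fun h4 X).trans ?_
  exact (DFunLike.congr_fun h5 _).symm

/-- The left-invariant field of `X` reads `y ↦ DM(y, 1)(0, X)` in the chart, with `M` the
multiplication. Its value at the identity is `X`, so the bracket is the antisymmetrized mixed second
derivative of `M`. -/
theorem bracketOne_eq (X Y : E) :
    bracketOne E D X Y =
      fderiv ℝ (fderiv ℝ (coordMul E D)) (toCoord E (1 : D), toCoord E (1 : D)) (X, 0) (0, Y) -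
      fderiv ℝ (fderiv ℝ (coordMul E D)) (toCoord E (1 : D), toCoord E (1 : D)) (Y, 0) (0, X) := by
  have : IsManifold 𝓘(ℝ, E) ∞ D := LieGroup.toContMDiffMul.toIsManifold
  have : IsManifold 𝓘(ℝ, E) 1 D := IsManifold.of_le (n := ∞) (by simp)
  let A : E →L[ℝ] E := mfderiv 𝓘(ℝ, E) 𝓘(ℝ, E) (extChartAt 𝓘(ℝ, E) (1 : D)) (1 : D)
  let field (X : E) (y : E) : E := VectorField.mpullbackWithin 𝓘(ℝ, E) 𝓘(ℝ, E)
    (extChartAt 𝓘(ℝ, E) (1 : D)).symm (mulInvariantVectorField (X : GroupLieAlgebra 𝓘(ℝ, E) D))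
    (Set.range 𝓘(ℝ, E)) y
  have h1 : bracketOne E D X Y = A.inverse (VectorField.lieBracketWithin ℝ (field X) (field Y)
      ((extChartAt 𝓘(ℝ, E) (1 : D)).symm ⁻¹' Set.univ ∩ Set.range 𝓘(ℝ, E))
      (toCoord E (1 : D))) := rfl
  have hA : A = ContinuousLinearMap.id ℝ E := mfderiv_extChartAt_self
  have h2 : ((extChartAt 𝓘(ℝ, E) (1 : D)).symm ⁻¹' Set.univ ∩ Set.range 𝓘(ℝ, E)) = Set.univ := by
    simp
  rw [hA, ContinuousLinearMap.inverse_id, h2, VectorField.lieBracketWithin_univ] at h1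
  refine h1.trans ?_
  have hder : ∀ X : E, HasFDerivAt
      (fun y : E => fderiv ℝ (coordMul E D) (y, toCoord E (1 : D)) (0, X))
      ((ContinuousLinearMap.apply ℝ E (0, X)) ∘L fderiv ℝ (fderiv ℝ (coordMul E D))
        (toCoord E (1 : D), toCoord E (1 : D)) ∘L ContinuousLinearMap.inl ℝ E E)
      (toCoord E (1 : D)) := by
    intro X
    have hM := ((contDiffAt_coordMul (E := E) (D := D)).fderiv_right
      (m := ∞) (by simp)).differentiableAt (by simp)
    exact (ContinuousLinearMap.apply ℝ E (0, X)).hasFDerivAt.comp _ (HasFDerivAt.comp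
      (f := fun y : E => (y, toCoord E (1 : D))) _ hM.hasFDerivAt (hasFDerivAt_prodMk_left _ _))
  have eX := eventually_mpullback_mulInvariantVectorField (D := D) X
  have eY := eventually_mpullback_mulInvariantVectorField (D := D) Y
  have e3 := Filter.EventuallyEq.lieBracket_vectorField_eq (𝕜 := ℝ) eX eY
  refine e3.trans ?_
  rw [VectorField.lieBracket, (hder X).fderiv, (hder Y).fderiv]
  simp [fderiv_coordMul_one]

/-- The logarithmic derivative near a point in terms of the multiplication in the chart. -/
theorem eventually_rightDeriv_eq {u : S → D} {O : Set S} (hO : IsOpen O)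
    (hu : ContMDiffOn 𝓘(ℝ, S) 𝓘(ℝ, E) ∞ u O) {x : S} (hx : x ∈ O) :
    ∀ᶠ z in 𝓝 x, rightDeriv E u z =
      fderiv ℝ (coordMul E D) (toCoord E (u z * (u x)⁻¹), toCoord E (u x * (u z)⁻¹)) ∘L
        (ContinuousLinearMap.inl ℝ E E ∘L fderiv ℝ (fun y => toCoord E (u y * (u x)⁻¹)) z) := by
  have : IsManifold 𝓘(ℝ, E) ∞ D := LieGroup.toContMDiffMul.toIsManifold
  have hux : ContMDiffAt 𝓘(ℝ, S) 𝓘(ℝ, E) ∞ u x := hu.contMDiffAt (hO.mem_nhds hx)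
  have hv : ContMDiffAt 𝓘(ℝ, S) 𝓘(ℝ, E) ∞ (fun z => u z * (u x)⁻¹) x := hux.mul contMDiffAt_const
  have hw : ContMDiffAt 𝓘(ℝ, S) 𝓘(ℝ, E) ∞ (fun z => u x * (u z)⁻¹) x :=
    contMDiffAt_const.mul hux.inv
  have hV := contDiffAt_toCoord_comp hv (by simp)
  have hW := contDiffAt_toCoord_comp hw (by simp)
  have hV1 : ∀ᶠ z in 𝓝 x, DifferentiableAt ℝ (fun y => toCoord E (u y * (u x)⁻¹)) z := by
    filter_upwards [(hV.of_le (m := 1) (by simp)).eventually (by simp)] with z hz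
    exact hz.differentiableAt (by simp)
  have hM : ∀ᶠ z in 𝓝 x, DifferentiableAt ℝ (coordMul E D)
      (toCoord E (u z * (u x)⁻¹), toCoord E (u x * (u z)⁻¹)) := by
    have h1 : ∀ᶠ p in 𝓝 (toCoord E (1 : D), toCoord E (1 : D)),
        ContDiffAt ℝ 1 (coordMul E D) p :=
      (contDiffAt_coordMul.of_le (by simp)).eventually (by simp)
    have h2 := (hV.continuousAt.prodMk hW.continuousAt).tendsto
    simp only [mul_inv_cancel] at h2
    filter_upwards [h2.eventually h1] with y hy
    exact hy.differentiableAt (by simp)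
  have tend : ∀ {v : S → D}, ContMDiffAt 𝓘(ℝ, S) 𝓘(ℝ, E) ∞ v x → v x = 1 →
      Tendsto v (𝓝 x) (𝓝 1) := by
    intro v hv hx
    have := hv.continuousAt
    rwa [ContinuousAt, hx] at this
  have e1 := (tend hv (by simp)).eventually (eventually_ofCoord_toCoord (E := E))
  have e2 := (tend hw (by simp)).eventually (eventually_ofCoord_toCoord (E := E))
  filter_upwards [hO.mem_nhds hx, hV1, hM, e1.eventually_nhds, e2] with z hz hVz hMz e1z e2z
  rw [rightDeriv_eq_fderiv (hu.contMDiffAt (hO.mem_nhds hz))]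
  -- The factorization `u y (u z)⁻¹ = (u y (u x)⁻¹)(u x (u z)⁻¹)` replaces the moving base point `z`
  -- by the fixed `x`.
  have e : (fun y => toCoord E (u y * (u z)⁻¹)) =ᶠ[𝓝 z] coordMul E D ∘
      fun y => (toCoord E (u y * (u x)⁻¹), toCoord E (u x * (u z)⁻¹)) := by
    filter_upwards [e1z] with y hy
    simp only [Function.comp_apply, coordMul, hy, e2z]
    congr 1
    group
  rw [e.fderiv_eq]
  have h := HasFDerivAt.comp (f := fun y => (toCoord E (u y * (u x)⁻¹), toCoord E (u x * (u z)⁻¹)))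
    z hMz.hasFDerivAt (hVz.hasFDerivAt.prodMk (hasFDerivAt_const _ _))
  rw [h.fderiv]
  congr 1

/-- The definition translates by a different group element at each point; the local formula with one
fixed base point makes smoothness in the point visible. -/
theorem contDiffAt_rightDeriv {u : S → D} {O : Set S} (hO : IsOpen O)
    (hu : ContMDiffOn 𝓘(ℝ, S) 𝓘(ℝ, E) ∞ u O) {x : S} (hx : x ∈ O) :
    ContDiffAt ℝ ∞ (rightDeriv E u) x := by
  have : IsManifold 𝓘(ℝ, E) ∞ D := LieGroup.toContMDiffMul.toIsManifold
  have hux : ContMDiffAt 𝓘(ℝ, S) 𝓘(ℝ, E) ∞ u x := hu.contMDiffAt (hO.mem_nhds hx)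
  have hv : ContMDiffAt 𝓘(ℝ, S) 𝓘(ℝ, E) ∞ (fun z => u z * (u x)⁻¹) x := hux.mul contMDiffAt_const
  have hw : ContMDiffAt 𝓘(ℝ, S) 𝓘(ℝ, E) ∞ (fun z => u x * (u z)⁻¹) x :=
    contMDiffAt_const.mul hux.inv
  have hV := contDiffAt_toCoord_comp hv (by simp)
  have hW := contDiffAt_toCoord_comp hw (by simp)
  refine ContDiffAt.congr_of_eventuallyEq ?_ (eventually_rightDeriv_eq hO hu hx)
  refine ContDiffAt.clm_comp ?_ (contDiffAt_const.clm_comp (hV.fderiv_right (by simp)))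
  refine ContDiffAt.comp (g := fderiv ℝ (coordMul E D)) x ?_ (hV.prodMk hW)
  simp only [mul_inv_cancel]
  exact contDiffAt_coordMul.fderiv_right (by simp)

/-- The Maurer-Cartan equation `dθ = θ ∧ θ` for the right-invariant form. -/
theorem maurerCartan {u : S → D} {O : Set S} (hO : IsOpen O)
    (hu : ContMDiffOn 𝓘(ℝ, S) 𝓘(ℝ, E) ∞ u O) {x : S} (hx : x ∈ O) (v w : S) :
    fderiv ℝ (rightDeriv E u) x v w - fderiv ℝ (rightDeriv E u) x w v =
      bracketOne E D (rightDeriv E u x v) (rightDeriv E u x w) := by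
  have : IsManifold 𝓘(ℝ, E) ∞ D := LieGroup.toContMDiffMul.toIsManifold
  have hux : ContMDiffAt 𝓘(ℝ, S) 𝓘(ℝ, E) ∞ u x := hu.contMDiffAt (hO.mem_nhds hx)
  have hv : ContMDiffAt 𝓘(ℝ, S) 𝓘(ℝ, E) ∞ (fun z => u z * (u x)⁻¹) x := hux.mul contMDiffAt_const
  have hw : ContMDiffAt 𝓘(ℝ, S) 𝓘(ℝ, E) ∞ (fun z => u x * (u z)⁻¹) x :=
    contMDiffAt_const.mul hux.inv
  have hV := contDiffAt_toCoord_comp hv (by simp)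
  have hW := contDiffAt_toCoord_comp hw (by simp)
  have hT := rightDeriv_eq_fderiv hux
  have hVx : toCoord E (u x * (u x)⁻¹) = toCoord E (1 : D) := by simp
  set V := fun y => toCoord E (u y * (u x)⁻¹) with hVdef
  set W := fun y => toCoord E (u x * (u y)⁻¹) with hWdef
  set T := rightDeriv E u x with hTdef
  have hV1 : HasFDerivAt V T x := by
    rw [hT]; exact (hV.differentiableAt (by simp)).hasFDerivAt
  -- The two factors are inverse to each other in `D`, so their first derivatives at `x` add up to
  -- zero.
  have hW1 : HasFDerivAt W (-T) x := by
    have h := fderiv_toCoord_mul hv hw (by simp) (by simp)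
    have e : (fun y => toCoord E (u y * (u x)⁻¹ * (u x * (u y)⁻¹))) =
        fun _ => toCoord E (1 : D) := by
      ext y; congr 1; group
    rw [e, fderiv_const_apply, ← hT] at h
    have h' : fderiv ℝ W x = -T := by
      rw [eq_comm, neg_eq_iff_add_eq_zero]
      exact h.symm
    rw [← h']
    exact (hW.differentiableAt (by simp)).hasFDerivAt
  have hM2 : HasFDerivAt (fderiv ℝ (coordMul E D)) (fderiv ℝ (fderiv ℝ (coordMul E D))
      (toCoord E (1 : D), toCoord E (1 : D))) (V x, W x) := by
    simp only [hVdef, hWdef, mul_inv_cancel]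
    exact ((contDiffAt_coordMul.fderiv_right (m := ∞) (by simp)).differentiableAt
      (by simp)).hasFDerivAt
  have hV2 : HasFDerivAt (fderiv ℝ V) (fderiv ℝ (fderiv ℝ V) x) x :=
    ((hV.fderiv_right (m := ∞) (by simp)).differentiableAt (by simp)).hasFDerivAt
  have hG := (HasFDerivAt.comp (f := fun y => (V y, W y)) x hM2 (hV1.prodMk hW1)).clm_comp
    ((hasFDerivAt_const (ContinuousLinearMap.inl ℝ E E) x).clm_comp hV2)
  have hθ : fderiv ℝ (rightDeriv E u) x = _ :=
    (hG.congr_of_eventuallyEq (eventually_rightDeriv_eq hO hu hx)).fderiv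
  have hsymM : IsSymmSndFDerivAt ℝ (coordMul E D) (toCoord E (1 : D), toCoord E (1 : D)) :=
    contDiffAt_coordMul.isSymmSndFDerivAt two_le_infty
  have hsymV : IsSymmSndFDerivAt ℝ V x := hV.isSymmSndFDerivAt two_le_infty
  have hc : fderiv ℝ (fun y => toCoord E (u y * (u x)⁻¹)) x = T := hV1.fderiv
  have hder : ∀ a b, fderiv ℝ (rightDeriv E u) x a b =
      fderiv ℝ (coordMul E D) (V x, W x) (fderiv ℝ (fderiv ℝ V) x a b, 0) +
      fderiv ℝ (fderiv ℝ (coordMul E D)) (toCoord E (1 : D), toCoord E (1 : D))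
        (T a, -T a) (T b, 0) := by
    intro a b
    rw [hθ]
    simp [hV1.fderiv]
  -- In the antisymmetrization the second derivative of `V` and the second derivatives of `M` along
  -- `(·, 0), (·, 0)` cancel by symmetry; the mixed ones form the bracket.
  have hneg : ∀ X : E, ((X, -X) : E × E) = (X, 0) - (0, X) := fun X => by simp
  rw [bracketOne_eq, hder, hder, hsymV.eq v w, hneg, hneg, map_sub, map_sub,
    sub_apply, sub_apply, hsymM.eq (T v, 0) (T w, 0),
    hsymM.eq (0, T w) (T v, 0), hsymM.eq (0, T v) (T w, 0)]
  abel

end MaurerCartan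

/-! ### Integrals of divergences and conservation along a deformation -/

section Integration

open Filter Topology

variable {X : Type*} [NormedAddCommGroup X] [NormedSpace ℝ X] [FiniteDimensional ℝ X]
  [MeasureSpace X] [BorelSpace X] [(volume : Measure X).IsAddHaarMeasure]

/-- The integral of the derivative of a function vanishes if the function vanishes outside a
compact subset of its open domain. -/
theorem setIntegral_fderiv_eq_zero {U W : Set X} (hU : IsOpen U) (hW : IsCompact W) (hWU : W ⊆ U)
    {a : X → ℝ} (ha : ∀ x ∈ U, ContDiffAt ℝ 1 a x) (ha0 : ∀ x ∈ U \ W, a x = 0) (v : X) :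
    ∫ x in W, fderiv ℝ a x v = 0 := by
  classical
  -- Extension by zero gives a `C¹` function with compact support on the whole space, which can be
  -- integrated by parts against the constant `1`.
  set c : X → ℝ := U.indicator a with hc
  have hcU : ∀ x ∈ U, c =ᶠ[𝓝 x] a := fun x hx => by
    filter_upwards [hU.mem_nhds hx] with y hy using Set.indicator_of_mem hy a
  have hc0 : ∀ x ∉ W, c x = 0 := fun x hx => by
    by_cases hxU : x ∈ U
    · rw [hc, Set.indicator_of_mem hxU, ha0 x ⟨hxU, hx⟩]
    · exact Set.indicator_of_notMem hxU a
  have hcW : ∀ x ∉ W, c =ᶠ[𝓝 x] fun _ => 0 := fun x hx => by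
    filter_upwards [hW.isClosed.isOpen_compl.mem_nhds hx] with y hy using hc0 y hy
  have hcd : ContDiff ℝ 1 c := contDiff_iff_contDiffAt.2 fun x => by
    by_cases hxW : x ∈ W
    · exact (ha x (hWU hxW)).congr_of_eventuallyEq (hcU x (hWU hxW))
    · exact contDiffAt_const.congr_of_eventuallyEq (hcW x hxW)
  have hcs : HasCompactSupport c := HasCompactSupport.intro hW hc0
  have hint : Integrable fun x => fderiv ℝ c x v := by
    refine Continuous.integrable_of_hasCompactSupport ?_ ?_
    · exact (hcd.continuous_fderiv (by simp)).clm_apply continuous_const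
    · exact (hcs.fderiv (𝕜 := ℝ)).comp_left (g := fun L : X →L[ℝ] ℝ => L v) (by simp)
  have h1 : ∫ x in W, fderiv ℝ a x v = ∫ x in W, fderiv ℝ c x v :=
    setIntegral_congr_fun hW.measurableSet fun x hx => by
      simp only [(hcU x (hWU hx)).fderiv_eq]
  rw [h1, setIntegral_eq_integral_of_forall_compl_eq_zero fun x hx => by
    rw [(hcW x hx).fderiv_eq]; simp]
  have h2 := integral_mul_fderiv_eq_neg_fderiv_mul_of_integrable (μ := (volume : Measure X))
    (f := fun _ => (1 : ℝ)) (g := c) (v := v) (by simp) (by simpa using hint)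
    (by simpa using hcd.continuous.integrable_of_hasCompactSupport hcs)
    (fun _ _ => differentiableAt_const _) (fun x _ => hcd.differentiable (by simp) x)
  simpa using h2

/-- The integral over space of a density whose time derivative is a divergence of functions that
vanish outside a compact set is conserved. -/
theorem setIntegral_eq_of_fderiv_eq_divergence {U W : Set X} (hU : IsOpen U) (hW : IsCompact W)
    (hWU : W ⊆ U) {L a b : ℝ × X → ℝ} (hL : ∀ z : ℝ × X, z.2 ∈ U → ContDiffAt ℝ 1 L z)
    (ha : ∀ z : ℝ × X, z.2 ∈ U → ContDiffAt ℝ 1 a z)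
    (hb : ∀ z : ℝ × X, z.2 ∈ U → ContDiffAt ℝ 1 b z)
    (ha0 : ∀ z : ℝ × X, z.2 ∈ U \ W → a z = 0) (hb0 : ∀ z : ℝ × X, z.2 ∈ U \ W → b z = 0)
    {v w : X} (h : ∀ z : ℝ × X, z.2 ∈ U →
      fderiv ℝ L z (1, 0) = fderiv ℝ a z (0, v) + fderiv ℝ b z (0, w)) :
    ∫ x in W, L (1, x) = ∫ x in W, L (0, x) := by
  have hslice : ∀ {a : ℝ × X → ℝ}, (∀ z : ℝ × X, z.2 ∈ U → ContDiffAt ℝ 1 a z) →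
      ∀ s, ∀ x ∈ U, ContDiffAt ℝ 1 (fun y => a (s, y)) x := fun ha s x hx =>
    ContDiffAt.comp (f := fun y => (s, y)) x (ha (s, x) hx) (contDiffAt_const.prodMk contDiffAt_id)
  have hslice' : ∀ {a : ℝ × X → ℝ}, (∀ z : ℝ × X, z.2 ∈ U → ContDiffAt ℝ 1 a z) →
      ∀ s, ∀ x ∈ U, ∀ v, fderiv ℝ (fun y => a (s, y)) x v = fderiv ℝ a (s, x) (0, v) := by
    intro a ha s x hx v
    have h1 := HasFDerivAt.comp (f := fun y => (s, y)) x
      ((ha (s, x) hx).differentiableAt (by simp)).hasFDerivAt (hasFDerivAt_prodMk_right s x)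
    exact DFunLike.congr_fun h1.fderiv v
  have hcont : ∀ {a : ℝ × X → ℝ}, (∀ z : ℝ × X, z.2 ∈ U → ContDiffAt ℝ 1 a z) →
      ∀ s, ContinuousOn (fun y => a (s, y)) W := fun ha s x hx =>
    (hslice ha s x (hWU hx)).continuousAt.continuousWithinAt
  have hdcont : ∀ {a : ℝ × X → ℝ}, (∀ z : ℝ × X, z.2 ∈ U → ContDiffAt ℝ 1 a z) →
      ∀ v, ContinuousOn (fun z => fderiv ℝ a z v) (Set.univ ×ˢ U) := fun ha v z hz =>
    (((ha z hz.2).fderiv_right (m := 0) (by simp)).continuousAt.clm_apply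
      continuousAt_const).continuousWithinAt
  have hzero : ∀ s, ∫ x in W, fderiv ℝ L (s, x) (1, 0) = 0 := by
    intro s
    have h1 : ∫ x in W, fderiv ℝ L (s, x) (1, 0) =
        ∫ x in W, (fderiv ℝ a (s, x) (0, v) + fderiv ℝ b (s, x) (0, w)) :=
      setIntegral_congr_fun hW.measurableSet fun x hx => h (s, x) (hWU hx)
    have hi : ∀ {a : ℝ × X → ℝ}, (∀ z : ℝ × X, z.2 ∈ U → ContDiffAt ℝ 1 a z) → ∀ v,
        IntegrableOn (fun x => fderiv ℝ a (s, x) v) W := fun ha v =>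
      ((hdcont ha v).comp (f := fun x => (s, x)) (by fun_prop)
        fun x hx => ⟨trivial, hWU hx⟩).integrableOn_compact hW
    have hz : ∀ {a : ℝ × X → ℝ}, (∀ z : ℝ × X, z.2 ∈ U → ContDiffAt ℝ 1 a z) →
        (∀ z : ℝ × X, z.2 ∈ U \ W → a z = 0) → ∀ v, ∫ x in W, fderiv ℝ a (s, x) (0, v) = 0 := by
      intro a ha ha0 v
      refine Eq.trans ?_
        (setIntegral_fderiv_eq_zero hU hW hWU (hslice ha s) (fun x hx => ha0 (s, x) hx) v)
      exact setIntegral_congr_fun hW.measurableSet fun x hx => (hslice' ha s x (hWU hx) v).symm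
    rw [h1, integral_add (hi ha _) (hi hb _), hz ha ha0, hz hb hb0, add_zero]
  -- The difference of the end values is an integral over `s`; by Fubini it is an integral of the
  -- space integrals `hzero`.
  have hFTC : ∀ x ∈ W, L (1, x) - L (0, x) = ∫ s in (0 : ℝ)..1, fderiv ℝ L (s, x) (1, 0) := by
    intro x hx
    rw [intervalIntegral.integral_eq_sub_of_hasDerivAt (f := fun s => L (s, x))]
    · intro s _
      have h1 := HasFDerivAt.comp (f := fun s : ℝ => (s, x)) s
        ((hL (s, x) (hWU hx)).differentiableAt (by simp)).hasFDerivAt (hasFDerivAt_prodMk_left s x)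
      exact h1.hasDerivAt
    · refine ContinuousOn.intervalIntegrable ?_
      exact (hdcont hL (1, 0)).comp (f := fun s : ℝ => (s, x)) (by fun_prop)
        fun s _ => ⟨trivial, hWU hx⟩
  rw [← sub_eq_zero, ← integral_sub ((hcont hL 1).integrableOn_compact hW)
    ((hcont hL 0).integrableOn_compact hW), setIntegral_congr_fun hW.measurableSet hFTC]
  have hprod : IntegrableOn (fun z : ℝ × X => fderiv ℝ L z (1, 0)) (Set.Icc 0 1 ×ˢ W)
      (volume.prod volume) := by
    refine ((hdcont hL (1, 0)).mono ?_).integrableOn_compact (isCompact_Icc.prod hW)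
    exact Set.prod_mono (Set.subset_univ _) hWU
  simp only [intervalIntegral.integral_of_le zero_le_one]
  rw [integral_integral_swap]
  · simp [hzero]
  · have h1 : IntegrableOn (fun z : ℝ × X => fderiv ℝ L z (1, 0)) (Set.Ioc 0 1 ×ˢ W)
      (volume.prod volume) := hprod.mono_set (Set.prod_mono Set.Ioc_subset_Icc_self subset_rfl)
    rw [IntegrableOn, ← Measure.prod_restrict] at h1
    exact h1.swap

end Integration

/-! ### The pulled-back equation for `dB` and the divergence identity -/

section Action

open Filter Topology

variable {E : Type*} [NormedAddCommGroup E] [NormedSpace ℝ E]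
  {D : Type*} [TopologicalSpace D] [ChartedSpace E D] [Group D]

theorem contDiffAt_alternatingMap_apply {Z : Type*} [NormedAddCommGroup Z]
    [NormedSpace ℝ Z] {n : WithTop ℕ∞} {g : Z → E [⋀^Fin 2]→L[ℝ] ℝ} {x y : Z → E} {z : Z}
    (hg : ContDiffAt ℝ n g z)
    (hx : ContDiffAt ℝ n x z) (hy : ContDiffAt ℝ n y z) :
    ContDiffAt ℝ n (fun z => g z ![x z, y z]) z := by
  -- Currying by continuous linear maps reduces the evaluation on two moving vectors to repeated
  -- application of continuous linear maps.
  obtain ⟨c₁, hc₁⟩ : ∃ c : (E [⋀^Fin 2]→L[ℝ] ℝ) →L[ℝ]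
      E →L[ℝ] ContinuousMultilinearMap ℝ (fun _ : Fin 1 => E) ℝ,
      ∀ g x v, c g x v = g (Fin.cons x v) :=
    ⟨(continuousMultilinearCurryLeftEquiv ℝ (fun _ : Fin 2 => E) ℝ :
      ContinuousMultilinearMap ℝ (fun _ : Fin 2 => E) ℝ →L[ℝ]
        (E →L[ℝ] ContinuousMultilinearMap ℝ (fun _ : Fin 1 => E) ℝ)) ∘L
        ContinuousAlternatingMap.toContinuousMultilinearMapCLM ℝ, fun _ _ _ => rfl⟩
  obtain ⟨c₂, hc₂⟩ : ∃ c : ContinuousMultilinearMap ℝ (fun _ : Fin 1 => E) ℝ →L[ℝ] E →L[ℝ] ℝ,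
      ∀ g x, c g x = g (Fin.snoc 0 x) :=
    ⟨(continuousMultilinearCurryFin1 ℝ E ℝ :
      ContinuousMultilinearMap ℝ (fun _ : Fin 1 => E) ℝ →L[ℝ] (E →L[ℝ] ℝ)), fun _ _ => rfl⟩
  have hd₁ : ContDiff ℝ n c₁ := by fun_prop
  have hd₂ : ContDiff ℝ n c₂ := by fun_prop
  have h0 : ContDiffAt ℝ n (fun z => c₁ (g z)) z :=
    ContDiffAt.comp (g := c₁) z hd₁.contDiffAt hg
  have h1 : ContDiffAt ℝ n (fun z => c₁ (g z) (x z)) z := h0.clm_apply hx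
  have h1' : ContDiffAt ℝ n (fun z => c₂ (c₁ (g z) (x z))) z :=
    ContDiffAt.comp (g := c₂) z hd₂.contDiffAt h1
  have h2 : ContDiffAt ℝ n (fun z => c₂ (c₁ (g z) (x z)) (y z)) z := h1'.clm_apply hy
  refine h2.congr_of_eventuallyEq (Eventually.of_forall fun z => ?_)
  simp only [hc₁, hc₂]
  congr 1
  ext i
  fin_cases i <;> rfl

/-- The pull-back of the equation for the exterior derivative of a Wess-Zumino primitive. -/
theorem IsWZPrimitive.fderiv_eq [LieGroup 𝓘(ℝ, E) ∞ D]
    {form : LinearMap.BilinForm ℝ (GroupLieAlgebra 𝓘(ℝ, E) D)}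
    {b : D → E [⋀^Fin 2]→L[ℝ] ℝ} (hb : IsWZPrimitive form b) {O : Set (ℝ × ℝ × ℝ)}
    {u : ℝ × ℝ × ℝ → D} (hO : IsOpen O) (hu : ContMDiffOn 𝓘(ℝ, ℝ × ℝ × ℝ) 𝓘(ℝ, E) ∞ u O)
    {z : ℝ × ℝ × ℝ} (hz : z ∈ O) (v₀ v₁ v₂ : ℝ × ℝ × ℝ) :
    fderiv ℝ (fun z => b (u z) ![rightDeriv E u z v₁, rightDeriv E u z v₂]) z v₀ -
      fderiv ℝ (fun z => b (u z) ![rightDeriv E u z v₀, rightDeriv E u z v₂]) z v₁ +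
      fderiv ℝ (fun z => b (u z) ![rightDeriv E u z v₀, rightDeriv E u z v₁]) z v₂ =
    6 * form (rightDeriv E u z v₀)
      (bracketOne E D (rightDeriv E u z v₁) (rightDeriv E u z v₂)) := by
  have h := hb.2 O u hO hu z hz ![v₀, v₁, v₂]
  have hbu : DifferentiableAt ℝ (fun z => b (u z)) z :=
    (((hb.1.contMDiffAt).comp z (hu.contMDiffAt (hO.mem_nhds hz))).contDiffAt).differentiableAt
      (by simp)
  have hd : DifferentiableAt ℝ
      (fun z => (b (u z)).compContinuousLinearMap (rightDeriv E u z)) z :=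
    hbu.continuousAlternatingMapCompContinuousLinearMap
      ((contDiffAt_rightDeriv hO hu hz).differentiableAt (by simp))
  have h1 := extDeriv_apply hd ![v₀, v₁, v₂]
  have h2 : ∀ x y : ℝ × ℝ × ℝ, (fun z => (b (u z)).compContinuousLinearMap (rightDeriv E u z)
      ![x, y]) = fun z => b (u z) ![rightDeriv E u z x, rightDeriv E u z y] := by
    intro x y
    ext z
    rw [ContinuousAlternatingMap.compContinuousLinearMap_apply]
    congr 1
    ext i
    fin_cases i <;> rfl
  have e0 : (0 : Fin 3).removeNth ![v₀, v₁, v₂] = ![v₁, v₂] := by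
    ext i : 1; fin_cases i <;> rfl
  have e1 : (1 : Fin 3).removeNth ![v₀, v₁, v₂] = ![v₀, v₂] := by
    ext i : 1; fin_cases i <;> rfl
  have e2 : (2 : Fin 3).removeNth ![v₀, v₁, v₂] = ![v₀, v₁] := by
    ext i : 1; fin_cases i <;> rfl
  rw [Fin.sum_univ_three, e0, e1, e2, h2, h2, h2] at h1
  have h3 := h1.symm.trans h
  simp only [Fin.val_zero, Fin.val_one, Fin.val_two, pow_zero, pow_one, one_smul, neg_smul,
    even_two, Even.neg_pow, one_pow] at h3
  rw [sub_eq_add_neg]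
  exact h3

/-- The time derivative of the action density is a divergence. The functions `p`, `t`, `q` are the
three components of a flat connection, and `p`, `r` are components of a second one. -/
theorem fderiv_density_eq_divergence {Z : Type*} [NormedAddCommGroup Z] [NormedSpace ℝ Z]
    (β : E →L[ℝ] E →L[ℝ] ℝ) (br : E → E → E) (hβ : ∀ X Y, β X Y = β Y X)
    (hbr : ∀ X Y, br X Y = -br Y X) (hβbr : ∀ X Y Z, β (br X Y) Z = β X (br Y Z))
    {p t q r : Z → E} {w₀₁ w₀₂ w₁₂ : Z → ℝ} {z e₀ e₁ e₂ : Z}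
    (hp : DifferentiableAt ℝ p z) (ht : DifferentiableAt ℝ t z) (hq : DifferentiableAt ℝ q z)
    (hr : DifferentiableAt ℝ r z) (hw₀₁ : DifferentiableAt ℝ w₀₁ z)
    (hw₀₂ : DifferentiableAt ℝ w₀₂ z) (hw₁₂ : DifferentiableAt ℝ w₁₂ z)
    (hpt : fderiv ℝ t z e₀ - fderiv ℝ p z e₁ = br (p z) (t z))
    (hpq : fderiv ℝ q z e₀ - fderiv ℝ p z e₂ = br (p z) (q z))
    (htq : fderiv ℝ q z e₁ - fderiv ℝ t z e₂ = br (t z) (q z))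
    (hpr : fderiv ℝ r z e₀ - fderiv ℝ p z e₁ = br (p z) (r z))
    (hrp : β (r z) (fderiv ℝ p z e₂) = 0)
    (hw : fderiv ℝ w₁₂ z e₀ - fderiv ℝ w₀₂ z e₁ + fderiv ℝ w₀₁ z e₂ =
      6 * β (p z) (br (t z) (q z))) :
    fderiv ℝ (fun z => 1 / 2 * β (t z) (q z) - 1 / 12 * w₁₂ z - β (r z) (q z)) z e₀ =
      fderiv ℝ (fun z => -(1 / 2 * β (p z) (q z)) - 1 / 12 * w₀₂ z) z e₁ +
        fderiv ℝ (fun z => 1 / 2 * β (p z) (t z) + 1 / 12 * w₀₁ z) z e₂ := by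
  have hβf : ∀ {x y : Z → E}, DifferentiableAt ℝ x z → DifferentiableAt ℝ y z →
      DifferentiableAt ℝ (fun z => β (x z) (y z)) z ∧ ∀ e, fderiv ℝ (fun z => β (x z) (y z)) z e =
        β (fderiv ℝ x z e) (y z) + β (x z) (fderiv ℝ y z e) := by
    intro x y hx hy
    have h := (β.hasFDerivAt.comp z hx.hasFDerivAt).clm_apply hy.hasFDerivAt
    refine ⟨h.differentiableAt, fun e => ?_⟩
    have h' := DFunLike.congr_fun h.fderiv e
    simp only [Function.comp_apply] at h'
    rw [h']
    simp [add_comm]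
  obtain ⟨d1, f1⟩ := hβf ht hq
  obtain ⟨d2, f2⟩ := hβf hr hq
  obtain ⟨d3, f3⟩ := hβf hp hq
  obtain ⟨d4, f4⟩ := hβf hp ht
  have g1 := ((d1.hasFDerivAt.const_mul (1 / 2)).sub (hw₁₂.hasFDerivAt.const_mul (1 / 12))).sub
    d2.hasFDerivAt
  have g2 := (d3.hasFDerivAt.const_mul (1 / 2)).neg.sub (hw₀₂.hasFDerivAt.const_mul (1 / 12))
  have g3 := (d4.hasFDerivAt.const_mul (1 / 2)).add (hw₀₁.hasFDerivAt.const_mul (1 / 12))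
  have k1 := DFunLike.congr_fun g1.fderiv e₀
  have k2 := DFunLike.congr_fun g2.fderiv e₁
  have k3 := DFunLike.congr_fun g3.fderiv e₂
  simp only [add_apply, sub_apply, neg_apply,
    smul_apply, f1, f2, f3, f4, smul_eq_mul] at k1 k2 k3
  refine k1.trans (Eq.trans ?_ (congrArg₂ (· + ·) k2 k3).symm)
  have hpt' := sub_eq_iff_eq_add.1 hpt
  have hpq' := sub_eq_iff_eq_add.1 hpq
  have hpr' := sub_eq_iff_eq_add.1 hpr
  have hw' : fderiv ℝ w₁₂ z e₀ = 6 * β (p z) (br (t z) (q z)) + fderiv ℝ w₀₂ z e₁ -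
      fderiv ℝ w₀₁ z e₂ := by linarith
  -- By invariance the bracket terms produced by `∂_s t`, `∂_s r` and `∂_s q` cancel in pairs.
  have i1 : β (br (p z) (t z)) (q z) = -β (t z) (br (p z) (q z)) := by
    rw [hbr, map_neg, neg_apply, hβbr]
  have i2 : β (br (p z) (r z)) (q z) = -β (r z) (br (p z) (q z)) := by
    rw [hbr, map_neg, neg_apply, hβbr]
  -- The Wess-Zumino term contributes `-6/12 = -1/2` times `⟨p|[t, q]⟩`. Writing `[t, q]` as `∂_τ q
  -- - ∂_σ t` supplies the terms that complete the total derivatives of `⟨p|q⟩` and `⟨p|t⟩`.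
  rw [hpt', hpq', hpr', hw', ← htq]
  simp only [map_add, map_sub, add_apply, i1, i2, hrp]
  rw [hβ (t z) (fderiv ℝ p z e₂)]
  ring

end Action

/-! ### Constancy of the action along a deformation -/

section GaugeInvariance

open Filter Topology

variable {E : Type*} [NormedAddCommGroup E] [NormedSpace ℝ E]
  {D : Type*} [TopologicalSpace D] [ChartedSpace E D] [Group D] [LieGroup 𝓘(ℝ, E) ∞ D]

theorem bracketOne_skew (X Y : E) : bracketOne E D X Y = -bracketOne E D Y X := by
  rw [bracketOne_eq, bracketOne_eq, neg_sub]

theorem alternatingMap_apply_swap (g : E [⋀^Fin 2]→L[ℝ] ℝ) (X Y : E) : g ![X, Y] = -g ![Y, X] := by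
  have h := g.toAlternatingMap.map_swap ![Y, X] (i := 0) (j := 1) (by decide)
  have e : ![Y, X] ∘ Equiv.swap (0 : Fin 2) 1 = ![X, Y] := by
    ext i : 1
    fin_cases i <;> rfl
  rw [e] at h
  exact h

section Slices

variable {X : Type*} [NormedAddCommGroup X] [NormedSpace ℝ X]

theorem rightDeriv_slice {u : ℝ × X → D} {U : Set X} (hU : IsOpen U)
    (hu : ContMDiffOn 𝓘(ℝ, ℝ × X) 𝓘(ℝ, E) ∞ u (Set.univ ×ˢ U)) (s : ℝ) {x : X} (hx : x ∈ U)
    (v : X) : rightDeriv E (fun y => u (s, y)) x v = rightDeriv E u (s, x) (0, v) := by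
  have h := rightDeriv_comp (g := fun y : X => (s, y))
    (hu.contMDiffAt ((isOpen_univ.prod hU).mem_nhds (⟨trivial, hx⟩ : (s, x) ∈ Set.univ ×ˢ U)))
    (contDiffAt_const.prodMk contDiffAt_id)
  rw [h, (hasFDerivAt_prodMk_right s x).fderiv]
  rfl

theorem rightDeriv_mul_snd {k : ℝ × X → D} {l : X → D} {U : Set X} (hU : IsOpen U)
    (hk : ContMDiffOn 𝓘(ℝ, ℝ × X) 𝓘(ℝ, E) ∞ k (Set.univ ×ˢ U))
    (hl : ContMDiffOn 𝓘(ℝ, X) 𝓘(ℝ, E) ∞ l U) {z : ℝ × X} (hz : z.2 ∈ U) (v : ℝ × X) :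
    rightDeriv E (fun z => k z * l z.2) z v =
      rightDeriv E k z v + adjoint E (k z) (rightDeriv E l z.2 v.2) := by
  have hl' := hl.contMDiffAt (hU.mem_nhds hz)
  have hls : ContMDiffAt 𝓘(ℝ, ℝ × X) 𝓘(ℝ, E) ∞ (fun z : ℝ × X => l z.2) z :=
    ContMDiffAt.comp (g := l) z hl' contDiffAt_snd.contMDiffAt
  rw [rightDeriv_mul (hk.contMDiffAt ((isOpen_univ.prod hU).mem_nhds ⟨trivial, hz⟩)) hls,
    rightDeriv_comp (g := fun z : ℝ × X => z.2) hl' contDiffAt_snd, fderiv_snd]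
  rfl

end Slices

/-- The action density along a deformation `u` of the field whose gauge part is `k`, with the
two contributions of the Lagrange multiplier that depend on the deformation. -/
def deformationDensity (β : E →L[ℝ] E →L[ℝ] ℝ) (b : D → E [⋀^Fin 2]→L[ℝ] ℝ)
    (u k : ℝ × ℝ × ℝ → D) (z : ℝ × ℝ × ℝ) : ℝ :=
  1 / 2 * β (rightDeriv E u z (0, 1, 0)) (rightDeriv E u z (0, 0, 1)) -
    1 / 12 * b (u z) ![rightDeriv E u z (0, 1, 0), rightDeriv E u z (0, 0, 1)] -
    β (rightDeriv E k z (0, 1, 0)) (rightDeriv E u z (0, 0, 1))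

section

variable {form : LinearMap.BilinForm ℝ (GroupLieAlgebra 𝓘(ℝ, E) D)}
  {b : D → E [⋀^Fin 2]→L[ℝ] ℝ} (β : E →L[ℝ] E →L[ℝ] ℝ)
  {U W : Set (ℝ × ℝ)} {k : ℝ × ℝ × ℝ → D} {l : ℝ × ℝ → D}

theorem contDiffAt_form_rightDeriv (v w : ℝ × ℝ × ℝ) {Z : Set (ℝ × ℝ × ℝ)} (hZ : IsOpen Z)
    {u k : ℝ × ℝ × ℝ → D} (hu : ContMDiffOn 𝓘(ℝ, ℝ × ℝ × ℝ) 𝓘(ℝ, E) ∞ u Z)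
    (hk : ContMDiffOn 𝓘(ℝ, ℝ × ℝ × ℝ) 𝓘(ℝ, E) ∞ k Z) {z : ℝ × ℝ × ℝ} (hz : z ∈ Z) :
    ContDiffAt ℝ ∞ (fun z => β (rightDeriv E u z v) (rightDeriv E k z w)) z := by
  have h1 := (contDiffAt_rightDeriv hZ hu hz).clm_apply (contDiffAt_const (c := v))
  have h2 := (contDiffAt_rightDeriv hZ hk hz).clm_apply (contDiffAt_const (c := w))
  have hβ : ContDiff ℝ ∞ β := by fun_prop
  exact (ContDiffAt.comp (g := β) z hβ.contDiffAt h1).clm_apply h2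

theorem contDiffAt_twoForm_rightDeriv (hb : ContMDiff 𝓘(ℝ, E) 𝓘(ℝ, E [⋀^Fin 2]→L[ℝ] ℝ) ∞ b)
    (v w : ℝ × ℝ × ℝ) {Z : Set (ℝ × ℝ × ℝ)} (hZ : IsOpen Z)
    {u : ℝ × ℝ × ℝ → D} (hu : ContMDiffOn 𝓘(ℝ, ℝ × ℝ × ℝ) 𝓘(ℝ, E) ∞ u Z)
    {z : ℝ × ℝ × ℝ} (hz : z ∈ Z) :
    ContDiffAt ℝ ∞ (fun z => b (u z) ![rightDeriv E u z v, rightDeriv E u z w]) z := by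
  have h1 := (contDiffAt_rightDeriv hZ hu hz).clm_apply (contDiffAt_const (c := v))
  have h2 := (contDiffAt_rightDeriv hZ hu hz).clm_apply (contDiffAt_const (c := w))
  exact contDiffAt_alternatingMap_apply
    ((hb.contMDiffAt.comp z (hu.contMDiffAt (hZ.mem_nhds hz))).contDiffAt) h1 h2

theorem contDiffAt_deformationDensity (hb : ContMDiff 𝓘(ℝ, E) 𝓘(ℝ, E [⋀^Fin 2]→L[ℝ] ℝ) ∞ b)
    {Z : Set (ℝ × ℝ × ℝ)} (hZ : IsOpen Z)
    {u k : ℝ × ℝ × ℝ → D} (hu : ContMDiffOn 𝓘(ℝ, ℝ × ℝ × ℝ) 𝓘(ℝ, E) ∞ u Z)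
    (hk : ContMDiffOn 𝓘(ℝ, ℝ × ℝ × ℝ) 𝓘(ℝ, E) ∞ k Z) {z : ℝ × ℝ × ℝ} (hz : z ∈ Z) :
    ContDiffAt ℝ ∞ (deformationDensity β b u k) z :=
  ((contDiffAt_const.mul (contDiffAt_form_rightDeriv β _ _ hZ hu hu hz)).sub
    (contDiffAt_const.mul (contDiffAt_twoForm_rightDeriv hb _ _ hZ hu hz))).sub
    (contDiffAt_form_rightDeriv β _ _ hZ hk hu hz)

theorem contMDiffOn_mul_snd (hk : ContMDiffOn 𝓘(ℝ, ℝ × ℝ × ℝ) 𝓘(ℝ, E) ∞ k (Set.univ ×ˢ U))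
    (hl : ContMDiffOn 𝓘(ℝ, ℝ × ℝ) 𝓘(ℝ, E) ∞ l U) :
    ContMDiffOn 𝓘(ℝ, ℝ × ℝ × ℝ) 𝓘(ℝ, E) ∞ (fun z => k z * l z.2) (Set.univ ×ˢ U) :=
  hk.mul (ContMDiffOn.comp (g := l) hl contDiff_snd.contMDiff.contMDiffOn fun _ hz => hz.2)

/-- The action is constant along a deformation by gauge transformations with values in an
isotropic subgroup. -/
theorem setIntegral_deformationDensity_eq (hform : ∀ X Y : E, form X Y = β X Y)
    (hβ : ∀ X Y, β X Y = β Y X)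
    (hβbr : ∀ X Y Z, β (bracketOne E D X Y) Z = β X (bracketOne E D Y Z))
    (hb : IsWZPrimitive form b) {ℱ : Submodule ℝ E} (hiso : ∀ X ∈ ℱ, ∀ Y ∈ ℱ, β X Y = 0)
    (hU : IsOpen U) (hW : IsCompact W) (hWU : W ⊆ U)
    (hk : ContMDiffOn 𝓘(ℝ, ℝ × ℝ × ℝ) 𝓘(ℝ, E) ∞ k (Set.univ ×ˢ U))
    (hl : ContMDiffOn 𝓘(ℝ, ℝ × ℝ) 𝓘(ℝ, E) ∞ l U)
    (hkF : ∀ z : ℝ × ℝ × ℝ, z.2 ∈ U → ∀ v, rightDeriv E k z v ∈ ℱ)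
    (hk1 : ∀ z : ℝ × ℝ × ℝ, z.2 ∈ U \ W → k z = 1) :
    ∫ x in W, deformationDensity β b (fun z => k z * l z.2) k (1, x) =
      ∫ x in W, deformationDensity β b (fun z => k z * l z.2) k (0, x) := by
  set u : ℝ × ℝ × ℝ → D := fun z => k z * l z.2 with hu_def
  set Z : Set (ℝ × ℝ × ℝ) := Set.univ ×ˢ U with hZ_def
  have hZ : IsOpen Z := isOpen_univ.prod hU
  have hu : ContMDiffOn 𝓘(ℝ, ℝ × ℝ × ℝ) 𝓘(ℝ, E) ∞ u Z := contMDiffOn_mul_snd hk hl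
  have hmem : ∀ {z : ℝ × ℝ × ℝ}, z.2 ∈ U → z ∈ Z := fun hz => ⟨trivial, hz⟩
  -- The field `l` does not depend on `s`, so `∂_s u u⁻¹` is `∂_s k k⁻¹`: it is `ℱ`-valued and
  -- vanishes outside `W`.
  have hs : ∀ z : ℝ × ℝ × ℝ, z.2 ∈ U → rightDeriv E u z (1, 0) = rightDeriv E k z (1, 0) := by
    intro z hz
    rw [rightDeriv_mul_snd hU hk hl hz]
    simp
  have hk0 : ∀ z : ℝ × ℝ × ℝ, z.2 ∈ U \ W → rightDeriv E k z = 0 := by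
    intro z hz
    have : k =ᶠ[𝓝 z] fun _ => (1 : D) := by
      have ho : IsOpen ((Set.univ : Set ℝ) ×ˢ (U \ W)) := isOpen_univ.prod (hU.sdiff hW.isClosed)
      filter_upwards [ho.mem_nhds ⟨trivial, hz⟩] with y hy using hk1 y hy.2
    rw [rightDeriv_congr this, rightDeriv_const]
  have le : (1 : WithTop ℕ∞) ≤ ∞ := by simp
  have hdiff : ∀ v, ∀ z : ℝ × ℝ × ℝ, z.2 ∈ U →
      DifferentiableAt ℝ (fun z => rightDeriv E u z v) z := fun v z hz =>
    ((contDiffAt_rightDeriv hZ hu (hmem hz)).clm_apply contDiffAt_const).differentiableAt (by simp)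
  have happ : ∀ {u : ℝ × ℝ × ℝ → D}, ContMDiffOn 𝓘(ℝ, ℝ × ℝ × ℝ) 𝓘(ℝ, E) ∞ u Z →
      ∀ v w, ∀ z : ℝ × ℝ × ℝ, z.2 ∈ U →
      fderiv ℝ (fun z => rightDeriv E u z v) z w = fderiv ℝ (rightDeriv E u) z w v := by
    intro u hu v w z hz
    have h := ((contDiffAt_rightDeriv hZ hu (hmem hz)).differentiableAt
      (by simp)).hasFDerivAt.clm_apply (hasFDerivAt_const v z)
    rw [h.fderiv]
    simp
  refine setIntegral_eq_of_fderiv_eq_divergence hU hW hWU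
    (a := fun z => -(1 / 2 * β (rightDeriv E u z (1, 0)) (rightDeriv E u z (0, 0, 1))) -
      1 / 12 * b (u z) ![rightDeriv E u z (1, 0), rightDeriv E u z (0, 0, 1)])
    (b := fun z => 1 / 2 * β (rightDeriv E u z (1, 0)) (rightDeriv E u z (0, 1, 0)) +
      1 / 12 * b (u z) ![rightDeriv E u z (1, 0), rightDeriv E u z (0, 1, 0)])
    (v := (1, 0)) (w := (0, 1)) (fun z hz => ?_) (fun z hz => ?_) (fun z hz => ?_)
    (fun z hz => ?_) (fun z hz => ?_) (fun z hz => ?_)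
  · exact (contDiffAt_deformationDensity β hb.1 hZ hu hk (hmem hz)).of_le le
  · exact (((contDiffAt_const.mul (contDiffAt_form_rightDeriv β _ _ hZ hu hu (hmem hz))).neg).sub
      (contDiffAt_const.mul (contDiffAt_twoForm_rightDeriv hb.1 _ _ hZ hu (hmem hz)))).of_le le
  · exact ((contDiffAt_const.mul (contDiffAt_form_rightDeriv β _ _ hZ hu hu (hmem hz))).add
      (contDiffAt_const.mul (contDiffAt_twoForm_rightDeriv hb.1 _ _ hZ hu (hmem hz)))).of_le le
  · have h0 := (b (u z)).toMultilinearMap.map_coord_zero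
      (m := ![(0 : E), rightDeriv E u z (0, 0, 1)]) 0 rfl
    have h0' : b (u z) ![0, rightDeriv E u z (0, 0, 1)] = 0 := h0
    simp [hs z hz.1, hk0 z hz, h0']
  · have h0 := (b (u z)).toMultilinearMap.map_coord_zero
      (m := ![(0 : E), rightDeriv E u z (0, 1, 0)]) 0 rfl
    have h0' : b (u z) ![0, rightDeriv E u z (0, 1, 0)] = 0 := h0
    simp [hs z hz.1, hk0 z hz, h0']
  · have hsk : (fun z => rightDeriv E u z (1, 0)) =ᶠ[𝓝 z] fun z => rightDeriv E k z (1, 0) := by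
      filter_upwards [hZ.mem_nhds (hmem hz)] with y hy using hs y hy.2
    have hw := hb.fderiv_eq hZ hu (hmem hz) (1, 0) (0, 1, 0) (0, 0, 1)
    rw [hform] at hw
    have mc : ∀ v w, fderiv ℝ (fun z => rightDeriv E u z w) z v -
        fderiv ℝ (fun z => rightDeriv E u z v) z w =
        bracketOne E D (rightDeriv E u z v) (rightDeriv E u z w) := by
      intro v w
      rw [happ hu _ _ z hz, happ hu _ _ z hz, maurerCartan hZ hu (hmem hz)]
    refine fderiv_density_eq_divergence β (bracketOne E D) hβ bracketOne_skew hβbr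
      (p := fun z => rightDeriv E u z (1, 0)) (t := fun z => rightDeriv E u z (0, 1, 0))
      (q := fun z => rightDeriv E u z (0, 0, 1)) (r := fun z => rightDeriv E k z (0, 1, 0))
      (e₀ := (1, 0)) (e₁ := (0, 1, 0)) (e₂ := (0, 0, 1))
      (hdiff _ z hz) (hdiff _ z hz) (hdiff _ z hz)
      (((contDiffAt_rightDeriv hZ hk (hmem hz)).clm_apply contDiffAt_const).differentiableAt
        (by simp))
      ((contDiffAt_twoForm_rightDeriv hb.1 _ _ hZ hu (hmem hz)).differentiableAt (by simp))
      ((contDiffAt_twoForm_rightDeriv hb.1 _ _ hZ hu (hmem hz)).differentiableAt (by simp))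
      ((contDiffAt_twoForm_rightDeriv hb.1 _ _ hZ hu (hmem hz)).differentiableAt (by simp))
      (mc _ _) (mc _ _) (mc _ _) ?_ ?_ hw
    · rw [hsk.fderiv_eq, hs z hz, happ hk _ _ z hz, happ hk _ _ z hz,
        maurerCartan hZ hk (hmem hz)]
    · rw [hsk.fderiv_eq]
      have hd : DifferentiableAt ℝ (fun z => rightDeriv E k z (1, 0)) z :=
        ((contDiffAt_rightDeriv hZ hk (hmem hz)).clm_apply contDiffAt_const).differentiableAt
          (by simp)
      have h1 := (β (rightDeriv E k z (0, 1, 0))).hasFDerivAt.comp z hd.hasFDerivAt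
      -- With the first argument frozen at `z`, isotropy makes the pairing with the `ℱ`-valued `∂_s
      -- k k⁻¹` vanish near `z`, hence also its derivative.
      have h2 : (β (rightDeriv E k z (0, 1, 0)) ∘ fun z => rightDeriv E k z (1, 0)) =ᶠ[𝓝 z]
          fun _ => 0 := by
        filter_upwards [hZ.mem_nhds (hmem hz)] with y hy
        exact hiso _ (hkF z hz _) _ (hkF y hy.2 _)
      have h3 := h1.fderiv
      rw [h2.fderiv_eq, fderiv_const_apply] at h3
      exact (DFunLike.congr_fun h3 _).symm

end

end GaugeInvariance

/-! ### Gauge transformation of the action -/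

section GaugeTransformation

open Filter Topology

variable {E : Type*} [NormedAddCommGroup E] [NormedSpace ℝ E] [FiniteDimensional ℝ E]
  {D : Type*} [TopologicalSpace D] [ChartedSpace E D] [Group D] [LieGroup 𝓘(ℝ, E) ∞ D]
  {E₁ : Type*} [NormedAddCommGroup E₁] [NormedSpace ℝ E₁]
  {F : Type*} [TopologicalSpace F] [ChartedSpace E₁ F] [Group F] [LieGroup 𝓘(ℝ, E₁) ∞ F]

/-- A bilinear form on a finite-dimensional space as a continuous bilinear map. -/
def continuousForm (form : LinearMap.BilinForm ℝ E) : E →L[ℝ] E →L[ℝ] ℝ :=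
  LinearMap.toContinuousLinearMap
    ((LinearMap.toContinuousLinearMap : (E →ₗ[ℝ] ℝ) ≃ₗ[ℝ] (E →L[ℝ] ℝ)).toLinearMap ∘ₗ form)

omit [LieGroup 𝓘(ℝ, E) ∞ D] in
-- The orientation `dσ ∧ dτ` is traded for a minus sign, to match the order `s, τ, σ` of the
-- directions used along the deformation.
theorem lagrangian_eq (form : LinearMap.BilinForm ℝ (GroupLieAlgebra 𝓘(ℝ, E) D))
    (b : D → E [⋀^Fin 2]→L[ℝ] ℝ) (K : E → ℝ) (l : ℝ × ℝ → D) (Λ : ℝ × ℝ → E) (x : ℝ × ℝ) :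
    lagrangian form b K l Λ x =
      1 / 2 * continuousForm (E := E) form (rightDeriv E l x (1, 0)) (rightDeriv E l x (0, 1)) -
        1 / 12 * b (l x) ![rightDeriv E l x (1, 0), rightDeriv E l x (0, 1)] +
        1 / 2 * K (rightDeriv E l x (0, 1)) +
        continuousForm (E := E) form (Λ x) (rightDeriv E l x (0, 1)) := by
  rw [alternatingMap_apply_swap, mul_neg, sub_neg_eq_add]
  rfl

/-- The potential `K` enters only through its values on `∂_σ l l⁻¹` and on the transform, so one
statement serves both `K = 0`, without constraint, and `quadK`, under the constraint. -/
theorem gauge_invariance {form : LinearMap.BilinForm ℝ (GroupLieAlgebra 𝓘(ℝ, E) D)}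
    {b : D → E [⋀^Fin 2]→L[ℝ] ℝ} {ι : F →* D} {ℱ : Submodule ℝ E}
    (hsymm : ∀ X Y, form X Y = form Y X)
    (hAd : ∀ (g : D) X Y, form (Ad E g X) (Ad E g Y) = form X Y)
    (had : ∀ X Y Z, form ⁅X, Y⁆ Z = form X ⁅Y, Z⁆)
    (hb : IsWZPrimitive form b) (hι : IsLieSubgroup (E₁ := E₁) ι ℱ)
    (hiso : ∀ X ∈ ℱ, ∀ Y ∈ ℱ, form X Y = 0)
    {U W : Set (ℝ × ℝ)} (hU : IsOpen U) (hW : IsCompact W) (hWU : W ⊆ U)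
    {f : ℝ × ℝ → F} (hf : IsGaugeTransformation (E₁ := E₁) U W f)
    {l : ℝ × ℝ → D} (hl : ContMDiffOn 𝓘(ℝ, ℝ × ℝ) 𝓘(ℝ, E) ∞ l U)
    {Λ : ℝ × ℝ → E} (hΛ : ContDiffOn ℝ ∞ Λ U) (hΛF : ∀ x ∈ U, Λ x ∈ ℱ) :
    (∀ x ∈ U, ∀ v, rightDeriv E (fun y => ι (f y)) x v ∈ ℱ) ∧
    (∀ x ∈ U, ∀ v, rightDeriv E (gaugeField ι f l) x v =
      rightDeriv E (fun y => ι (f y)) x v + adjoint E (ι (f x)) (rightDeriv E l x v)) ∧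
    ∀ K : E → ℝ, ContinuousOn (fun x => K (rightDeriv E l x (0, 1))) U →
      (∀ x ∈ U, K (rightDeriv E (gaugeField ι f l) x (0, 1)) = K (rightDeriv E l x (0, 1))) →
      IntegrableOn (lagrangian form b K l Λ) W ∧
      IntegrableOn (lagrangian form b K (gaugeField ι f l) (gaugeMultiplier ι f Λ)) W ∧
      action form b K W (gaugeField ι f l) (gaugeMultiplier ι f Λ) = action form b K W l Λ := by
  obtain ⟨h, hh, hh0, hh1, hhW⟩ := hf
  set k : ℝ × ℝ × ℝ → D := fun z => ι (h z) with hk_def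
  set u : ℝ × ℝ × ℝ → D := fun z => k z * l z.2 with hu_def
  have hk : ContMDiffOn 𝓘(ℝ, ℝ × ℝ × ℝ) 𝓘(ℝ, E) ∞ k (Set.univ ×ˢ U) :=
    hι.smooth.comp_contMDiffOn hh
  have hu : ContMDiffOn 𝓘(ℝ, ℝ × ℝ × ℝ) 𝓘(ℝ, E) ∞ u (Set.univ ×ˢ U) := contMDiffOn_mul_snd hk hl
  have hZ : IsOpen ((Set.univ : Set ℝ) ×ˢ U) := isOpen_univ.prod hU
  have hmem : ∀ (s : ℝ) {x : ℝ × ℝ}, x ∈ U → (s, x) ∈ (Set.univ : Set ℝ) ×ˢ U :=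
    fun s x hx => ⟨trivial, hx⟩
  have hderF : ∀ Y : E₁, derivOne E E₁ ι Y ∈ ℱ := fun Y => (hι.range_deriv _).2 ⟨Y, rfl⟩
  have hkF : ∀ z : ℝ × ℝ × ℝ, z.2 ∈ U → ∀ v, rightDeriv E k z v ∈ ℱ := by
    intro z hz v
    rw [hk_def, rightDeriv_hom hι.smooth (hh.contMDiffAt (hZ.mem_nhds ⟨trivial, hz⟩))]
    exact hderF _
  have hAdF : ∀ (g : F), ∀ X ∈ ℱ, adjoint E (ι g) X ∈ ℱ := by
    intro g X hX
    obtain ⟨Y, rfl⟩ := (hι.range_deriv X).1 hX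
    exact (adjoint_hom hι.smooth g Y).symm ▸ hderF _
  have ef : ∀ x ∈ U, (fun y => ι (f y)) =ᶠ[𝓝 x] fun y => k (1, y) := fun x hx => by
    filter_upwards [hU.mem_nhds hx] with y hy
    simp only [hk_def, hh1 y hy]
  have efl : ∀ x ∈ U, gaugeField ι f l =ᶠ[𝓝 x] fun y => u (1, y) := fun x hx => by
    filter_upwards [hU.mem_nhds hx] with y hy
    simp only [hu_def, hk_def, hh1 y hy, gaugeField]
  have df : ∀ x ∈ U, ∀ v, rightDeriv E (fun y => ι (f y)) x v = rightDeriv E k (1, x) (0, v) := by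
    intro x hx v
    rw [rightDeriv_congr (ef x hx), rightDeriv_slice hU hk 1 hx]
  have dfl : ∀ x ∈ U, ∀ v, rightDeriv E (gaugeField ι f l) x v =
      rightDeriv E u (1, x) (0, v) := by
    intro x hx v
    rw [rightDeriv_congr (efl x hx), rightDeriv_slice hU hu 1 hx]
  have hmul : ∀ x ∈ U, ∀ v, rightDeriv E (gaugeField ι f l) x v =
      rightDeriv E (fun y => ι (f y)) x v + adjoint E (ι (f x)) (rightDeriv E l x v) := by
    intro x hx v
    rw [dfl x hx, df x hx, hu_def, rightDeriv_mul_snd hU hk hl (z := (1, x)) hx]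
    simp only [hk_def, hh1 x hx]
  refine ⟨fun x hx v => df x hx v ▸ hkF (1, x) hx _, hmul, fun K hKc hK => ?_⟩
  set β := continuousForm (E := E) form with hβ_def
  have hβiso : ∀ X ∈ ℱ, ∀ Y ∈ ℱ, β X Y = 0 := hiso
  have hβAd : ∀ g : D, ∀ X Y : E, β (adjoint E g X) (adjoint E g Y) = β X Y := hAd
  -- The part of the density that is the same at both ends of the deformation.
  let base : ℝ × ℝ → ℝ := fun x =>
    1 / 2 * K (rightDeriv E l x (0, 1)) + β (Λ x) (rightDeriv E l x (0, 1))
  have e1 : ∀ x ∈ U, lagrangian form b K (gaugeField ι f l) (gaugeMultiplier ι f Λ) x =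
      deformationDensity β b u k (1, x) + base x := by
    intro x hx
    have h1 : (gaugeMultiplier ι f Λ x : E) =
        adjoint E (ι (f x)) (Λ x) - rightDeriv E k (1, x) (0, 1, 0) := by
      rw [← df x hx]
      rfl
    have h2 : gaugeField ι f l x = u (1, x) := (efl x hx).self_of_nhds
    have h3 : rightDeriv E u (1, x) (0, 0, 1) = rightDeriv E k (1, x) (0, 0, 1) +
        adjoint E (ι (f x)) (rightDeriv E l x (0, 1)) := by
      rw [← dfl x hx, ← df x hx, hmul x hx]
    -- The rotated multiplier `Ad_f Λ` lies in `ℱ` and does not see `∂_σ f f⁻¹`; its pairing with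
    -- `Ad_f (∂_σ l l⁻¹)` is the original one.
    have h4 : β (gaugeMultiplier ι f Λ x : E) (rightDeriv E u (1, x) (0, 0, 1)) =
        β (Λ x) (rightDeriv E l x (0, 1)) -
          β (rightDeriv E k (1, x) (0, 1, 0)) (rightDeriv E u (1, x) (0, 0, 1)) := by
      rw [h1, map_sub, sub_apply]
      congr 1
      rw [h3, map_add, hβAd, hβiso _ (hAdF _ _ (hΛF x hx)) _ (hkF (1, x) hx _), zero_add]
    refine (lagrangian_eq form b K (gaugeField ι f l) (gaugeMultiplier ι f Λ) x).trans ?_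
    rw [hK x hx, h2]
    simp only [dfl x hx]
    refine (congrArg₂ (· + ·) rfl h4).trans ?_
    simp only [deformationDensity, base]
    ring
  have e0 : ∀ x ∈ U, lagrangian form b K l Λ x = deformationDensity β b u k (0, x) + base x := by
    intro x hx
    have h1 : u (0, x) = l x := by simp [hu_def, hk_def, hh0 x hx]
    have h2 : ∀ v, rightDeriv E u (0, x) (0, v) = rightDeriv E l x v := by
      intro v
      rw [← rightDeriv_slice hU hu 0 hx]
      congr 1
      refine rightDeriv_congr ?_
      filter_upwards [hU.mem_nhds hx] with y hy
      simp [hu_def, hk_def, hh0 y hy]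
    have h3 : ∀ v, rightDeriv E k (0, x) (0, v) = 0 := by
      intro v
      rw [← rightDeriv_slice hU hk 0 hx]
      have : (fun y => k (0, y)) =ᶠ[𝓝 x] fun _ => (1 : D) := by
        filter_upwards [hU.mem_nhds hx] with y hy
        simp [hk_def, hh0 y hy]
      rw [rightDeriv_congr this, rightDeriv_const]
      rfl
    refine (lagrangian_eq form b K l Λ x).trans ?_
    simp only [deformationDensity, base, h1, h2, h3, map_zero, zero_apply]
    ring
  have hld : ∀ x ∈ U, ContinuousAt (fun y => rightDeriv E l y (0, 1)) x := fun x hx =>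
    (contDiffAt_rightDeriv hU hl hx).continuousAt.clm_apply continuousAt_const
  have hbase : IntegrableOn base W := by
    refine ContinuousOn.integrableOn_compact hW ?_
    refine ((continuousOn_const.mul hKc).add fun x hx => ?_).mono hWU
    have h1 : ContinuousAt Λ x := (hΛ.continuousOn).continuousAt (hU.mem_nhds hx)
    exact ((β.continuous.continuousAt.comp h1).clm_apply (hld x hx)).continuousWithinAt
  have hdens : ∀ s : ℝ, IntegrableOn (fun x => deformationDensity β b u k (s, x)) W := by
    intro s
    refine ContinuousOn.integrableOn_compact hW fun x hx => ?_
    have h1 := (contDiffAt_deformationDensity β hb.1 hZ hu hk (hmem s (hWU hx))).continuousAt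
    exact (ContinuousAt.comp (f := fun y : ℝ × ℝ => (s, y)) h1 (by fun_prop)).continuousWithinAt
  have hinv := setIntegral_deformationDensity_eq (form := form) β (fun _ _ => rfl) hsymm had hb
    hβiso hU hW hWU hk hl hkF fun z hz => by simp [hk_def, hhW z.1 z.2 hz]
  refine ⟨?_, ?_, ?_⟩
  · exact ((hdens 0).add hbase).congr_fun (fun x hx => (e0 x (hWU hx)).symm) hW.measurableSet
  · exact ((hdens 1).add hbase).congr_fun (fun x hx => (e1 x (hWU hx)).symm) hW.measurableSet
  · have a1 : action form b K W (gaugeField ι f l) (gaugeMultiplier ι f Λ) =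
        ∫ x in W, (deformationDensity β b u k (1, x) + base x) :=
      setIntegral_congr_fun hW.measurableSet fun x hx => e1 x (hWU hx)
    have a0 : action form b K W l Λ = ∫ x in W, (deformationDensity β b u k (0, x) + base x) :=
      setIntegral_congr_fun hW.measurableSet fun x hx => e0 x (hWU hx)
    rw [a1, a0, integral_add (hdens 1) hbase, integral_add (hdens 0) hbase, hinv]

end GaugeTransformation

end DressingCosets

end

/-! ### The theorem -/

open DressingCosets in
theorem theorem5
    {E : Type*} [NormedAddCommGroup E] [NormedSpace ℝ E] [FiniteDimensional ℝ E] [CompleteSpace E]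
    {D : Type*} [TopologicalSpace D] [ChartedSpace E D] [Group D] [LieGroup 𝓘(ℝ, E) ∞ D]
    {E₁ : Type*} [NormedAddCommGroup E₁] [NormedSpace ℝ E₁] [FiniteDimensional ℝ E₁]
    {F : Type*} [TopologicalSpace F] [ChartedSpace E₁ F] [Group F] [LieGroup 𝓘(ℝ, E₁) ∞ F]
    [ConnectedSpace F]
    (form : LinearMap.BilinForm ℝ (GroupLieAlgebra 𝓘(ℝ, E) D))
    (𝒢 𝒢' : LieSubalgebra ℝ (GroupLieAlgebra 𝓘(ℝ, E) D))
    (hD : IsDrinfeldDouble form 𝒢 𝒢')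
    (R Rs R' Rs' : GroupLieAlgebra 𝓘(ℝ, E) D →ₗ.[ℝ] GroupLieAlgebra 𝓘(ℝ, E) D)
    (hR : OperatorHypotheses form 𝒢.toSubmodule 𝒢'.toSubmodule R Rs R' Rs')
    (hF_lie : ∀ X ∈ spaceF R Rs R', ∀ Y ∈ spaceF R Rs R', ⁅X, Y⁆ ∈ spaceF R Rs R')
    (ι : F →* D) (hF : IsLieSubgroup (E₁ := E₁) ι (spaceF R Rs R'))
    (h_int : ∀ f : F, IntertwiningIdentity
      (𝒢.toSubmodule.projection 𝒢'.toSubmodule hD.isCompl)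
      (𝒢'.toSubmodule.projection 𝒢.toSubmodule hD.isCompl.symm) R (Ad E (ι f)))
    (h_int' : ∀ f : F, IntertwiningIdentity
      (𝒢'.toSubmodule.projection 𝒢.toSubmodule hD.isCompl.symm)
      (𝒢.toSubmodule.projection 𝒢'.toSubmodule hD.isCompl) R' (Ad E (ι f)))
    (b : D → E [⋀^Fin 2]→L[ℝ] ℝ) (hb : IsWZPrimitive form b) :
    -- the quadratic form is well defined on the orthogonal of `ℱ`
    (∀ X ∈ form.orthogonal (spaceF R Rs R'),
      (∃ αp αm : R.domain, IsDecomposition R Rs R' X αp αm) ∧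
      ∀ αp αm : R.domain, IsDecomposition R Rs R' X αp αm →
        quadK form R Rs R' X = 2 * form αp (R αp) + 2 * form αm (R αm)) ∧
    -- the adjoint action of `F` preserves the kernels
    (∀ f : F, (∀ X ∈ opKer R, Ad E (ι f) X ∈ opKer R) ∧
      ∀ X ∈ opKer R', Ad E (ι f) X ∈ opKer R') ∧
    -- gauge symmetry
    ∀ (U W : Set (ℝ × ℝ)), IsOpen U → IsCompact W → W ⊆ U →
      ∀ f : ℝ × ℝ → F, IsGaugeTransformation (E₁ := E₁) U W f →
      ∀ l : ℝ × ℝ → D, ContMDiffOn 𝓘(ℝ, ℝ × ℝ) 𝓘(ℝ, E) ∞ l U →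
      ∀ Λ : ℝ × ℝ → E, ContDiffOn ℝ ∞ Λ U → (∀ x ∈ U, Λ x ∈ spaceF R Rs R') →
        -- the gauge transforms are fields of the same kind
        (∀ x ∈ U, gaugeMultiplier ι f Λ x ∈ spaceF R Rs R') ∧
        (∀ x ∈ U, dσ E (gaugeField ι f l) x ∈ form.orthogonal (spaceF R Rs R') ↔
          dσ E l x ∈ form.orthogonal (spaceF R Rs R')) ∧
        -- the action without `K` is invariant for all fields
        (IntegrableOn (lagrangian form b (fun _ => 0) l Λ) W ∧
          IntegrableOn (lagrangian form b (fun _ => 0) (gaugeField ι f l)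
            (gaugeMultiplier ι f Λ)) W ∧
          action form b (fun _ => 0) W (gaugeField ι f l) (gaugeMultiplier ι f Λ) =
            action form b (fun _ => 0) W l Λ) ∧
        -- the action is invariant for the fields that satisfy the constraint
        ((∀ x ∈ U, dσ E l x ∈ form.orthogonal (spaceF R Rs R')) →
          IntegrableOn (lagrangian form b (quadK form R Rs R') l Λ) W ∧
          IntegrableOn (lagrangian form b (quadK form R Rs R') (gaugeField ι f l)
            (gaugeMultiplier ι f Λ)) W ∧
          action form b (quadK form R Rs R') W (gaugeField ι f l) (gaugeMultiplier ι f Λ) =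
            action form b (quadK form R Rs R') W l Λ) := by
  have hP : IsLagrangianPair form 𝒢.toSubmodule 𝒢'.toSubmodule :=
    ⟨hD.symm, hD.nondegenerate, hD.isCompl, hD.isotropic, hD.isotropic'⟩
  have hfd : FiniteDimensional ℝ (GroupLieAlgebra 𝓘(ℝ, E) D) :=
    inferInstanceAs (FiniteDimensional ℝ E)
  have hAd_inv : ∀ (g : D) (X : GroupLieAlgebra 𝓘(ℝ, E) D),
      (Ad E g).toLinearMap ((Ad E g⁻¹).toLinearMap X) = X :=
    fun g X => adjoint_inv_apply (E := E) g X
  have hAd_inv' : ∀ (f : F) (X : GroupLieAlgebra 𝓘(ℝ, E) D),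
      (Ad E (ι f)).toLinearMap ((Ad E (ι f⁻¹)).toLinearMap X) = X := fun f X => by
    rw [map_inv]
    exact hAd_inv (ι f) X
  have hker : ∀ f : F, (∀ X ∈ opKer R, Ad E (ι f) X ∈ opKer R) ∧
      ∀ X ∈ opKer R', Ad E (ι f) X ∈ opKer R' := fun f =>
    ⟨fun X hX => map_opKer hR hP hD.isCompl (hAd_inv' f) (hD.invariant_Ad (ι f)) (h_int f)
      (h_int f⁻¹) (h_int' f⁻¹) hX,
    fun X hX => map_opKer hR.swap hP.swap hD.isCompl.symm (hAd_inv' f) (hD.invariant_Ad (ι f))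
      (h_int' f) (h_int' f⁻¹) (h_int f⁻¹) hX⟩
  -- The graph part is preserved by the identity for `R`, the summand `Ker R'` by the kernel
  -- statement; the orthogonal space then follows with `f⁻¹`.
  have hmapR : ∀ f : F, ∀ X ∈ spaceR R R', (Ad E (ι f)).toLinearMap X ∈ spaceR R R' :=
    fun f X hX => map_spaceR hR hD.isCompl (h_int f) (hker f).2 hX
  have hmapP : ∀ f : F, ∀ X ∈ spaceRPerp Rs R', (Ad E (ι f)).toLinearMap X ∈ spaceRPerp Rs R' :=
    fun f X hX => map_spaceRPerp hR hP (hAd_inv' f) (hD.invariant_Ad (ι f)) (hmapR f⁻¹) hX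
  refine ⟨fun X hX => ⟨exists_isDecomposition hR hP hX, fun αp αm h =>
    quadK_eq_of_isDecomposition hR hP h⟩, hker, ?_⟩
  intro U W hU hW hWU f hf l hl Λ hΛ hΛF
  obtain ⟨hρ, hmul, hinv⟩ := gauge_invariance hD.symm hD.invariant_Ad hD.invariant_ad hb hF
    (fun X hX Y hY => spaceF_isotropic hR hP hX hY) hU hW hWU hf hl hΛ hΛF
  have hρ' : ∀ x ∈ U, dσ E (fun y => ι (f y)) x ∈ spaceF R Rs R' := fun x hx => hρ x hx (0, 1)
  have hmul' : ∀ x ∈ U, dσ E (gaugeField ι f l) x =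
      dσ E (fun y => ι (f y)) x + (Ad E (ι (f x))).toLinearMap (dσ E l x) :=
    fun x hx => hmul x hx (0, 1)
  have hmapF : ∀ f : F, ∀ X ∈ spaceF R Rs R', (Ad E (ι f)).toLinearMap X ∈ spaceF R Rs R' :=
    fun f X hX => ⟨hmapR f X hX.1, hmapP f X hX.2⟩
  have horth : ∀ (f : F) (X : GroupLieAlgebra 𝓘(ℝ, E) D),
      (Ad E (ι f)).toLinearMap X ∈ form.orthogonal (spaceF R Rs R') ↔
      X ∈ form.orthogonal (spaceF R Rs R') := by
    intro f X
    constructor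
    · intro hX Y hY
      exact (hD.invariant_Ad (ι f) Y X).symm.trans (hX _ (hmapF f Y hY))
    · intro hX Y hY
      have h1 : form Y ((Ad E (ι f)).toLinearMap X) =
          form ((Ad E (ι f)).toLinearMap ((Ad E (ι f⁻¹)).toLinearMap Y))
            ((Ad E (ι f)).toLinearMap X) := by rw [hAd_inv']
      exact h1.trans ((hD.invariant_Ad (ι f) _ X).trans (hX _ (hmapF f⁻¹ Y hY)))
  refine ⟨fun x hx => ?_, fun x hx => ?_, ?_, fun hconstr => ?_⟩
  · exact sub_mem (hmapF _ _ (hΛF x hx)) (hρ x hx (1, 0))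
  · rw [hmul' x hx, ← horth (f x) (dσ E l x)]
    exact Submodule.add_mem_iff_right _ (spaceF_le_orthogonal hR hP (hρ' x hx))
  · exact hinv (fun _ => 0) continuousOn_const fun _ _ => rfl
  · refine hinv (quadK form R Rs R') ?_ fun x hx => ?_
    · refine ContinuousOn.comp (continuousOn_quadK (E := E) hR hP) (fun x hx => ?_) hconstr
      exact ((contDiffAt_rightDeriv hU hl hx).continuousAt.clm_apply
        continuousAt_const).continuousWithinAt
    · refine (congrArg (quadK form R Rs R') (hmul' x hx)).trans ?_
      refine quadK_map_add hR hP (hD.invariant_Ad _) (hmapR _) (hmapP _) ?_ (hρ' x hx)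
      rw [← orthogonal_spaceF hR hP]
      exact hconstr x hx
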